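/- Setting. Let $N\ge 1$, let $k$ be a unit modulo $N$ and let $\ell$ be the order of $k$ in $(\mathbb Z/N)^\times$. Let $\omega$ be a primitive $N$-th root of unity, $z$ an indeterminate, $K=\mathbb Q(\omega,z)$, let $\sigma$ be the automorphism of $K$ with $\sigma(\omega)=\omega^k$, $\sigma(z)=z$, and let $F$ be the fixed field of $\sigma$, so that $K/F$ is cyclic of degree $\ell$ (and $F=\mathbb Q(z)$ if $k$ generates $(\mathbb Z/N)^\times$). Let $D=(K/F,\sigma,z)=K\oplus Kx\oplus\cdots\oplus Kx^{\ell-1}$, with $x^\ell=z$ and $xb=\sigma(b)x$ for $b\in K$, be the corresponding cyclic division algebra of index $\ell$. It is regarded as the $F$-subalgebra of $\mathbb M_\ell(K)$ generated by the matrices $M(b)=\mathrm{diag}(b,\sigma(b),\dots,\sigma^{\ell-1}(b))$, $b\in K$, and $M(x)$, which has ones on the superdiagonal, $z$ in the lower left corner and zeros elsewhere ($M(x)=(z)$ if $\ell=1$). A generalized ABP of degree $d$ and width at most $r$ over $D$ in the variables $x_1,\dots,x_n$ is a layered directed graph with layers $0,\dots,d$ of at most $r$ vertices each, with edges only from each layer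 to the next, a source in layer $0$ and a sink in layer $d$, each edge being labelled by a linear form $\sum_{i=1}^n a_ix_ib_i$ with $a_i,b_i\in D$. It computes the generalized polynomial $B$ that is the sum over all source-to-sink paths of the ordered product of the edge labels. $B$ is nonzero if, when its coefficients are expanded in the basis of matrix units $e_{ij}$ of $\mathbb M_\ell(K)$, some canonical generalized monomial $e_{i_0j_0}x_{k_1}e_{i_1j_1}\cdots x_{k_d}e_{i_dj_d}$ has a nonzero coefficient. At $p\in\mathbb M_{d\ell}(K)^n$ a word $a_0x_{k_1}a_1\cdots x_{k_d}a_d$ takes the value $\iota(a_0)p_{k_1}\iota(a_1)\cdots p_{k_d}\iota(a_d)$, where $\iota(a)=a\otimes I_d$. Theorem. There are one deterministic algorithm and an absolute constant $c$ such that for all $N,k$ (hence $\ell$ and $D$) as above and all $n,r,d\ge1$ the algorithm, on input $(n,\ell,r,d,N,k)$, outputs a finite list $\mathcal H'$ of points of $\mathbb M_{d\ell}(K)^n$ with the following properties. 1. $|\mathcal H'|\le(nrd\ell+1)^{c(\lfloor\log_2(nd\ell)\rfloor+1)}$, i.e. $|\mathcal H'|=(nrd\ell)^{O(\log nd\ell)}$.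 2. The running time is quasipolynomial: it is at most $2^{(\lfloor\log_2(nrd\ell\cdot|N|)\rfloor+c)^c}$, where $|N|$ is the bit length of $N$. Time is the logarithmic cost on a random access machine; each matrix entry is output explicitly as a list of terms $(c_j,e_j,f_j)\in\mathbb Z\times\mathbb N\times\mathbb N$ standing for $\sum_j c_j\omega^{e_j}z^{f_j}$. 3. $\mathcal H'$ is a strong hitting set: for every generalized ABP of degree $d$ and width at most $r$ over $D$ in $n$ variables that computes a nonzero generalized polynomial $B$, there is $p\in\mathcal H'$ such that $B(p)$ is an invertible matrix. -/

import Mathlib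

/-! ### The cyclic division algebra `D = (K/F, σ, z)` -/

namespace GenABPHitting

noncomputable section

/-- The cyclotomic extension instance for the canonical `ℚ`-algebra structure of a field of
characteristic zero. -/
instance isCyclotomic (N : ℕ) [NeZero N] : IsCyclotomicExtension {N} ℚ (CyclotomicField N ℚ) :=
  CyclotomicField.isCyclotomicExtension N ℚ

/-- `K = ℚ(ω, z)`: rational functions in an indeterminate `z` over the `N`-th cyclotomic field. -/
abbrev KField (N : ℕ) [NeZero N] : Type := RatFunc (CyclotomicField N ℚ)

/-- A primitive `N`-th root of unity `ω` in `K`. -/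
def omega (N : ℕ) [NeZero N] : KField N :=
  RatFunc.C (IsCyclotomicExtension.zeta N ℚ (CyclotomicField N ℚ))

/-- The indeterminate `z` in `K`. -/
def zvar (N : ℕ) [NeZero N] : KField N := RatFunc.X

/-- The automorphism `σ` of `K = ℚ(ω, z)` with `σ ω = ω ^ k` and `σ z = z`
(see `sigma_omega`, `sigma_zvar`): the element of `Gal(ℚ(ω)/ℚ)` that corresponds to
`k ∈ (ℤ/N)ˣ`, applied to the coefficients of rational functions in `z`. -/
def sigma (N : ℕ) [NeZero N] (k : (ZMod N)ˣ) : KField N ≃+* KField N :=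
  IsFractionRing.ringEquivOfRingEquiv
    (Polynomial.mapEquiv
      ((IsCyclotomicExtension.Rat.galEquivZMod N (CyclotomicField N ℚ)).symm k).toRingEquiv)

theorem sigma_zvar (N : ℕ) [NeZero N] (k : (ZMod N)ˣ) : sigma N k (zvar N) = zvar N := by
  rw [zvar, ← RatFunc.algebraMap_X, sigma, IsFractionRing.ringEquivOfRingEquiv_algebraMap]
  simp

theorem sigma_omega (N : ℕ) [NeZero N] (k : (ZMod N)ˣ) :
    sigma N k (omega N) = omega N ^ (k : ZMod N).val := by
  have h := IsCyclotomicExtension.Rat.galEquivZMod_apply_of_pow_eq N (CyclotomicField N ℚ)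
    ((IsCyclotomicExtension.Rat.galEquivZMod N (CyclotomicField N ℚ)).symm k)
    (IsCyclotomicExtension.zeta_spec N ℚ (CyclotomicField N ℚ)).pow_eq_one
  rw [MulEquiv.apply_symm_apply] at h
  rw [omega, ← RatFunc.algebraMap_C, sigma, IsFractionRing.ringEquivOfRingEquiv_algebraMap]
  simp only [Polynomial.mapEquiv_apply, Polynomial.map_C, RatFunc.algebraMap_C]
  rw [← map_pow, ← h]
  rfl

/-- The fixed field `F = {a ∈ K | σ a = a}` of `σ`. -/
def baseField (N : ℕ) [NeZero N] (k : (ZMod N)ˣ) : Subfield (KField N) :=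
  RingHom.eqLocusField (sigma N k : KField N →+* KField N) (RingHom.id (KField N))

/-- The matrix `M(b) = diag(b, σ b, …, σ ^ (ℓ - 1) b)` of `b ∈ K`. -/
def Mdiag (N : ℕ) [NeZero N] (k : (ZMod N)ˣ) (ℓ : ℕ) (b : KField N) :
    Matrix (Fin ℓ) (Fin ℓ) (KField N) :=
  Matrix.diagonal fun i => (sigma N k)^[(i : ℕ)] b

/-- The matrix `M(x)`: ones on the superdiagonal and `z` in the lower left corner
(for `ℓ = 1` it is the matrix `(z)`). -/
def Mx (N : ℕ) [NeZero N] (ℓ : ℕ) : Matrix (Fin ℓ) (Fin ℓ) (KField N) :=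
  Matrix.of fun i j =>
    if (j : ℕ) = i + 1 then 1 else if (i : ℕ) + 1 = ℓ ∧ (j : ℕ) = 0 then zvar N else 0

/-- The algebra `D = (K/F, σ, z) = K ⊕ K x ⊕ ⋯ ⊕ K x ^ (ℓ - 1)`, `x ^ ℓ = z`, `x b = σ(b) x`, in its
regular matrix representation: the `F`-subalgebra of `M_ℓ(K)` generated by `M(x)` and the `M(b)`.
It is the cyclic division algebra of index `ℓ` when `ℓ` is the order of `σ`, that is,
`ℓ = orderOf k`. -/
def cyclicAlgebra (N : ℕ) [NeZero N] (k : (ZMod N)ˣ) (ℓ : ℕ) :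
    Subalgebra (baseField N k) (Matrix (Fin ℓ) (Fin ℓ) (KField N)) :=
  Algebra.adjoin (baseField N k) (insert (Mx N ℓ) (Set.range (Mdiag N k ℓ)))

/-! ### Generalized polynomials and generalized ABPs -/

/-- A generalized word `a₀ x_{k₁} a₁ x_{k₂} ⋯ x_{k_d} a_d` of degree `d` in `n` variables with
coefficients in `M_m(K)`. -/
structure GenWord (K : Type) (m n d : ℕ) where
  coeffs : Fin (d + 1) → Matrix (Fin m) (Fin m) K
  vars : Fin d → Fin n

/-- A canonical generalized monomial `e_{i₀ j₀} x_{k₁} e_{i₁ j₁} ⋯ x_{k_d} e_{i_d j_d}`,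
where the `e_{i j}` are the matrix units. -/
structure GenMonomial (m n d : ℕ) where
  row : Fin (d + 1) → Fin m
  col : Fin (d + 1) → Fin m
  vars : Fin d → Fin n

/-- The coefficient of a canonical generalized monomial in the expansion of a generalized word
in the basis of matrix units. -/
def GenWord.coeff {K : Type} [Field K] {m n d : ℕ} (w : GenWord K m n d)
    (μ : GenMonomial m n d) : K :=
  if w.vars = μ.vars then ∏ t, w.coeffs t (μ.row t) (μ.col t) else 0

/-- The inclusion `ι(a) = a ⊗ I_q` of `M_m(K)` into `M_{mq}(K)`. -/
def inclusion {K : Type} [Field K] {m : ℕ} (q : ℕ) (a : Matrix (Fin m) (Fin m) K) :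
    Matrix (Fin m × Fin q) (Fin m × Fin q) K :=
  Matrix.kronecker a (1 : Matrix (Fin q) (Fin q) K)

/-- The value `ι(a₀) p_{k₁} ι(a₁) ⋯ p_{k_d} ι(a_d)` of a generalized word at a matrix tuple. -/
def GenWord.eval {K : Type} [Field K] {m n d q : ℕ} (w : GenWord K m n d)
    (p : Fin n → Matrix (Fin m × Fin q) (Fin m × Fin q) K) :
    Matrix (Fin m × Fin q) (Fin m × Fin q) K :=
  inclusion q (w.coeffs 0) *
    (List.ofFn fun t : Fin d => p (w.vars t) * inclusion q (w.coeffs t.succ)).prod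

/-- A generalized ABP of degree `d` and width (at most) `r` in `n` variables over a subalgebra `D`
of `M_m(K)`. It has layers `0, …, d`; the vertices of each layer are indexed by `Fin r` (a narrower
layer is padded with isolated vertices). The edge from vertex `u` of layer `t` to vertex `v` of
layer `t + 1` carries the label `∑ i, (left t u v i) x_i (right t u v i)`; a missing edge is an
edge with label zero. -/
structure GenABP {K F : Type} [Field K] [Field F] [Algebra F K] {m : ℕ}
    (D : Subalgebra F (Matrix (Fin m) (Fin m) K)) (n d r : ℕ) where
  left : Fin d → Fin r → Fin r → Fin n → D
  right : Fin d → Fin r → Fin r → Fin n → D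
  source : Fin r
  sink : Fin r

namespace GenABP

variable {K F : Type} [Field K] [Field F] [Algebra F K] {m : ℕ}
  {D : Subalgebra F (Matrix (Fin m) (Fin m) K)} {n d r : ℕ}

/-- The source-to-sink paths: a path chooses one vertex in each of the layers `0, …, d`. -/
def paths (B : GenABP D n d r) : Finset (Fin (d + 1) → Fin r) :=
  Finset.univ.filter fun v => v 0 = B.source ∧ v (Fin.last d) = B.sink

/-- The generalized word obtained by multiplying out, along the path `v`, the terms
`a x_{k t} b` of the edge labels: its coefficients are `a₁, b₁ a₂, …, b_{d-1} a_d, b_d`. -/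
def word (B : GenABP D n d r) (v : Fin (d + 1) → Fin r) (k : Fin d → Fin n) :
    GenWord K m n d where
  coeffs t :=
    Fin.cons (α := fun _ => Matrix (Fin m) (Fin m) K) 1
        (fun s : Fin d => (B.right s (v s.castSucc) (v s.succ) (k s) : Matrix _ _ K)) t *
      Fin.snoc (α := fun _ => Matrix (Fin m) (Fin m) K)
        (fun s : Fin d => (B.left s (v s.castSucc) (v s.succ) (k s) : Matrix _ _ K)) 1 t
  vars := k

/-- The coefficient of a canonical generalized monomial in the generalized polynomial computed by
`B`, which is the sum over all source-to-sink paths of the ordered products of edge labels. -/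
def coeff (B : GenABP D n d r) (μ : GenMonomial m n d) : K :=
  ∑ v ∈ B.paths, ∑ k : Fin d → Fin n, (B.word v k).coeff μ

/-- The generalized polynomial computed by `B` is nonzero: some coefficient of its expansion in
canonical generalized monomials is nonzero. -/
def IsNonzero (B : GenABP D n d r) : Prop := ∃ μ : GenMonomial m n d, B.coeff μ ≠ 0

/-- The value of the generalized polynomial computed by `B` at a tuple of matrices of dimension
`mq`, under the inclusion `a ↦ a ⊗ I_q` of the coefficients. -/
def eval {q : ℕ} (B : GenABP D n d r)
    (p : Fin n → Matrix (Fin m × Fin q) (Fin m × Fin q) K) :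
    Matrix (Fin m × Fin q) (Fin m × Fin q) K :=
  ∑ v ∈ B.paths, ∑ k : Fin d → Fin n, (B.word v k).eval p

end GenABP

/-! ### Explicit points and their encoding -/

/-- An explicit element `∑ c ω ^ e z ^ f` of `ℤ[ω, z] ⊆ K`, as the list of its terms `(c, e, f)`. -/
abbrev Symb : Type := List (ℤ × ℕ × ℕ)

/-- The element of `K = ℚ(ω, z)` that a list of terms stands for. -/
def Symb.value (N : ℕ) [NeZero N] (a : Symb) : KField N :=
  (a.map fun τ => (τ.1 : KField N) * omega N ^ τ.2.1 * zvar N ^ τ.2.2).sum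

/-- A tuple of `n` explicitly written matrices of dimension `ℓ d`. -/
abbrev SymbPoint (n ℓ d : ℕ) : Type :=
  Fin n → Matrix (Fin ℓ × Fin d) (Fin ℓ × Fin d) Symb

/-- The point of `M_{ℓd}(K)ⁿ` that an explicitly written tuple stands for. -/
def SymbPoint.value (N : ℕ) [NeZero N] {n ℓ d : ℕ} (P : SymbPoint n ℓ d) :
    Fin n → Matrix (Fin ℓ × Fin d) (Fin ℓ × Fin d) (KField N) :=
  fun i => Matrix.of fun u v => Symb.value N (P i u v)

/-- An entry is written as the number of its terms, followed, for each term `(c, e, f)`, by the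
sign of `c`, the absolute value of `c`, and `e`, `f`. -/
def Symb.encode (a : Symb) : List ℕ :=
  a.length :: a.flatMap fun τ => [if τ.1 < 0 then 1 else 0, τ.1.natAbs, τ.2.1, τ.2.2]

/-- A point is written matrix by matrix, and each matrix row by row (row and column indices
`(i, j)` in lexicographic order). -/
def SymbPoint.encode {n ℓ d : ℕ} (P : SymbPoint n ℓ d) : List ℕ :=
  (List.finRange n).flatMap fun x =>
    (List.finRange ℓ).flatMap fun i => (List.finRange d).flatMap fun j =>
      (List.finRange ℓ).flatMap fun i' => (List.finRange d).flatMap fun j' =>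
        Symb.encode (P x (i, j) (i', j'))

end

/-! ### A random access machine with logarithmic cost

Programs act on a memory of natural numbers of arbitrary size, addressed by natural numbers, and
write natural numbers to an output tape. Every operation is charged for the bit lengths
(`Nat.size`) of all its operands and addresses; multiplication and division for their product. -/

/-- Arithmetic expressions; `mem a` reads the memory cell whose address is the value of `a`. -/
inductive RExpr : Type
  | const (c : ℕ)
  | mem (a : RExpr)
  | add (a b : RExpr)
  | sub (a b : RExpr)
  | mul (a b : RExpr)
  | div (a b : RExpr)
  | mod (a b : RExpr)

/-- The value of an expression (truncated subtraction, integer division). -/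
def RExpr.eval (σ : ℕ → ℕ) : RExpr → ℕ
  | const c => c
  | mem a => σ (a.eval σ)
  | add a b => a.eval σ + b.eval σ
  | sub a b => a.eval σ - b.eval σ
  | mul a b => a.eval σ * b.eval σ
  | div a b => a.eval σ / b.eval σ
  | mod a b => a.eval σ % b.eval σ

/-- The cost of evaluating an expression. -/
def RExpr.cost (σ : ℕ → ℕ) : RExpr → ℕ
  | const c => c.size + 1
  | mem a => a.cost σ + (a.eval σ).size + (σ (a.eval σ)).size + 1
  | add a b => a.cost σ + b.cost σ + (a.eval σ).size + (b.eval σ).size + 1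
  | sub a b => a.cost σ + b.cost σ + (a.eval σ).size + (b.eval σ).size + 1
  | mul a b => a.cost σ + b.cost σ + ((a.eval σ).size + 1) * ((b.eval σ).size + 1)
  | div a b => a.cost σ + b.cost σ + ((a.eval σ).size + 1) * ((b.eval σ).size + 1)
  | mod a b => a.cost σ + b.cost σ + ((a.eval σ).size + 1) * ((b.eval σ).size + 1)

/-- Programs: `store a e` writes the value of `e` to the cell with address the value of `a`,
`emit e` appends the value of `e` to the output, and conditions hold when nonzero. -/
inductive RProg : Type
  | skip
  | store (a e : RExpr)
  | emit (e : RExpr)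
  | seq (p q : RProg)
  | ite (e : RExpr) (p q : RProg)
  | loop (e : RExpr) (p : RProg)

/-- A machine state: the memory and the output written so far. -/
structure RState : Type where
  mem : ℕ → ℕ
  out : List ℕ

/-- `RExec p s s' T`: the program `p`, started in state `s`, halts in state `s'` at total
cost `T`. -/
inductive RExec : RProg → RState → RState → ℕ → Prop
  | skip (s : RState) : RExec .skip s s 1
  | store (a e : RExpr) (s : RState) :
      RExec (.store a e) s
        ⟨Function.update s.mem (a.eval s.mem) (e.eval s.mem), s.out⟩
        (a.cost s.mem + e.cost s.mem + (a.eval s.mem).size + (e.eval s.mem).size + 1)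
  | emit (e : RExpr) (s : RState) :
      RExec (.emit e) s ⟨s.mem, s.out ++ [e.eval s.mem]⟩
        (e.cost s.mem + (e.eval s.mem).size + 1)
  | seq {p q : RProg} {s s' s'' : RState} {T T' : ℕ} :
      RExec p s s' T → RExec q s' s'' T' → RExec (.seq p q) s s'' (T + T')
  | ite_true {e : RExpr} {p q : RProg} {s s' : RState} {T : ℕ} :
      e.eval s.mem ≠ 0 → RExec p s s' T → RExec (.ite e p q) s s' (e.cost s.mem + T + 1)
  | ite_false {e : RExpr} {p q : RProg} {s s' : RState} {T : ℕ} :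
      e.eval s.mem = 0 → RExec q s s' T → RExec (.ite e p q) s s' (e.cost s.mem + T + 1)
  | loop_stop {e : RExpr} {p : RProg} {s : RState} :
      e.eval s.mem = 0 → RExec (.loop e p) s s (e.cost s.mem + 1)
  | loop_step {e : RExpr} {p : RProg} {s s' s'' : RState} {T T' : ℕ} :
      e.eval s.mem ≠ 0 → RExec p s s' T → RExec (.loop e p) s' s'' T' →
        RExec (.loop e p) s s'' (e.cost s.mem + T + T' + 1)

/-- The initial state on a list of inputs: these stand in the cells `0, 1, 2, …`, all other cells
hold `0`, and the output is empty. -/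
def RState.init (inputs : List ℕ) : RState := ⟨fun i => inputs.getD i 0, []⟩

end GenABPHitting

/-! Strong hitting is reduced to nonvanishing. The matrix substituted for a variable `x` is
block-cyclic: it has blocks `q x s` in `D` at the positions `(s, s + 1)`, with `s` modulo `d`. A
product of `d` such matrices, with coefficients `a ⊗ I_d` in between, is block diagonal, and its
block `s` is the ABP evaluated with `q x (s + t)` for the variable `x` at position `t`
(`GenABP.eval_cyclicBlocks`). These blocks lie in `D`, where nonzero elements are invertible
(`isUnit_of_mem_cyclicAlgebra`, by comparing degrees in `z`). So one `q` has to make all `d` cyclic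
shifts nonzero at once.

Put `q x s = ∑ t ^ w(s, (x, a, b)) M(ω ^ a) M(x) ^ b` with a natural number `t`. The products `M(ω ^
a) M(x) ^ b` span the full matrix algebra over `K` (`exists_sum_basisElem`), so a nonzero
generalized polynomial does not vanish on all of them. The ABP thereby becomes a product of `d`
linear forms in the `n ℓ²` variables `(x, a, b)` with coefficients in `M_r(M_ℓ(K))`, of dimension
`(r ℓ)²`. If `w` isolates, for each shift, a set of words such that every other coefficient is a
combination of isolated ones of smaller weight, then the substitution gives a nonzero polynomial in
`t` (`IsIsolating.sum_monomial_ne_zero`).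

Such weights are built by doubling the length of the isolated blocks
(`BlocksIsolated.exists_double`). Isolating sets can be thinned to the dimension, so products of two
of them are small. Only polynomially many pairs of words have to be separated, and this is done by
residues of `enc v * α ^ τ` modulo a prime `p`, for a suitable `α`. There are logarithmically many
rounds, each with polynomially many pairs `(p, α)`. Finally `t` avoids the zeros of the product of
the `d` polynomials (`exists_choice_ne_zero`). The hitting set runs over all these choices, coded as
digits of one number `g`.

For the running time, a small program logic (`Run`) tracks an initial segment of the memory together
with the output and a cost bound. The program is a nest of counted loops, and one number bounds both
the loop lengths and the intermediate values. -/

namespace GenABPHitting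

/-! ### Cost and value bounds for expressions with fixed addresses -/

namespace RExpr

/-- The number of leaves of an expression. -/
def leaves : RExpr → ℕ
  | const _ => 1
  | mem _ => 1
  | add a b => a.leaves + b.leaves
  | sub a b => a.leaves + b.leaves
  | mul a b => a.leaves + b.leaves
  | div a b => a.leaves + b.leaves
  | mod a b => a.leaves + b.leaves

/-- The expression reads only cells with fixed addresses below `c`, and its constants are
small. -/
def Reads (c : ℕ) : RExpr → Prop
  | const v => v < 1024
  | mem (const a) => a < c ∧ a < 1024
  | mem _ => False
  | add a b => a.Reads c ∧ b.Reads c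
  | sub a b => a.Reads c ∧ b.Reads c
  | mul a b => a.Reads c ∧ b.Reads c
  | div a b => a.Reads c ∧ b.Reads c
  | mod a b => a.Reads c ∧ b.Reads c

theorem leaves_pos (e : RExpr) : 0 < e.leaves := by
  induction e <;> simp only [leaves] <;> omega

theorem eval_congr {c : ℕ} {μ ν : ℕ → ℕ} (h : ∀ i < c, μ i = ν i) :
    ∀ {e : RExpr}, e.Reads c → e.eval μ = e.eval ν
  | const _, _ => rfl
  | mem (const a), he => h a he.1
  | add a b, he => by simp only [eval, eval_congr h he.1, eval_congr h he.2]
  | sub a b, he => by simp only [eval, eval_congr h he.1, eval_congr h he.2]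
  | mul a b, he => by simp only [eval, eval_congr h he.1, eval_congr h he.2]
  | div a b, he => by simp only [eval, eval_congr h he.1, eval_congr h he.2]
  | mod a b, he => by simp only [eval, eval_congr h he.1, eval_congr h he.2]

theorem size_small {S v : ℕ} (hS : 10 ≤ S) (hv : v < 1024) : v.size ≤ S :=
  (Nat.size_le.2 (by simpa using hv : v < 2 ^ 10)).trans hS

theorem size_add_le {x y p q : ℕ} (hp : 0 < p) (hq : 0 < q) (hx : x.size ≤ p)
    (hy : y.size ≤ q) : (x + y).size ≤ p + q := by
  rw [Nat.size_le] at *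
  have h1 : 2 ≤ 2 ^ p := by simpa using Nat.pow_le_pow_right (n := 2) (by norm_num) hp
  have h2 : 2 ≤ 2 ^ q := by simpa using Nat.pow_le_pow_right (n := 2) (by norm_num) hq
  rw [pow_add]
  nlinarith

theorem size_mul_le {x y p q : ℕ} (hx : x.size ≤ p) (hy : y.size ≤ q) :
    (x * y).size ≤ p + q := by
  rw [Nat.size_le] at *
  rw [pow_add]
  exact Nat.mul_lt_mul'' hx hy

theorem size_eval_le {c S : ℕ} {μ : ℕ → ℕ} (hS : 10 ≤ S) (h : ∀ i < c, (μ i).size ≤ S) :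
    ∀ {e : RExpr}, e.Reads c → (e.eval μ).size ≤ e.leaves * S
  | const _, he => by simpa [leaves, eval] using size_small hS he
  | mem (const a), he => by simpa [leaves, eval] using h a he.1
  | add a b, he => by
      rw [leaves, add_mul]
      exact size_add_le (Nat.mul_pos a.leaves_pos (by omega)) (Nat.mul_pos b.leaves_pos (by omega))
        (size_eval_le hS h he.1) (size_eval_le hS h he.2)
  | sub a b, he => by
      rw [leaves, add_mul]
      exact ((Nat.size_le_size (Nat.sub_le _ _)).trans (size_eval_le hS h he.1)).trans
        (Nat.le_add_right _ _)
  | mul a b, he => by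
      rw [leaves, add_mul]
      exact size_mul_le (size_eval_le hS h he.1) (size_eval_le hS h he.2)
  | div a b, he => by
      rw [leaves, add_mul]
      exact ((Nat.size_le_size (Nat.div_le_self _ _)).trans (size_eval_le hS h he.1)).trans
        (Nat.le_add_right _ _)
  | mod a b, he => by
      rw [leaves, add_mul]
      exact ((Nat.size_le_size (Nat.mod_le _ _)).trans (size_eval_le hS h he.1)).trans
        (Nat.le_add_right _ _)

/-- The inductive step for the cost bound: the gap `24 a b (a + b)` between `8 (a + b) ^ 3` and `8 a
^ 3 + 8 b ^ 3` pays for a multiplication. Addition and subtraction are cheaper. -/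
theorem cost_node {S a b x y s t : ℕ} (hS : 10 ≤ S) (ha : 0 < a) (hb : 0 < b)
    (hx : x ≤ 8 * a ^ 3 * S ^ 2) (hy : y ≤ 8 * b ^ 3 * S ^ 2) (hs : s ≤ a * S) (ht : t ≤ b * S) :
    x + y + (s + 1) * (t + 1) ≤ 8 * (a + b) ^ 3 * S ^ 2 := by
  have h1 : s + 1 ≤ 2 * (a * S) := by nlinarith
  have h2 : t + 1 ≤ 2 * (b * S) := by nlinarith
  have h3 := Nat.mul_le_mul h1 h2
  have h4 : a * b * S ^ 2 ≤ a * b * (a + b) * S ^ 2 := by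
    refine Nat.mul_le_mul_right _ (Nat.le_mul_of_pos_right _ (by omega))
  nlinarith

theorem cost_le {c S : ℕ} {μ : ℕ → ℕ} (hS : 10 ≤ S) (h : ∀ i < c, (μ i).size ≤ S) :
    ∀ {e : RExpr}, e.Reads c → e.cost μ ≤ 8 * e.leaves ^ 3 * S ^ 2
  | const v, he => by
      have := size_small hS he
      simp only [cost, leaves]
      nlinarith
  | mem (const a), he => by
      have h1 := size_small hS he.2
      have h2 := h a he.1
      simp only [cost, eval, leaves]
      nlinarith
  | add a b, he => by
      have := cost_node hS a.leaves_pos b.leaves_pos (cost_le hS h he.1) (cost_le hS h he.2)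
        (size_eval_le hS h he.1) (size_eval_le hS h he.2)
      simp only [cost, leaves]
      refine le_trans ?_ this
      nlinarith [Nat.zero_le ((a.eval μ).size * (b.eval μ).size)]
  | sub a b, he => by
      have := cost_node hS a.leaves_pos b.leaves_pos (cost_le hS h he.1) (cost_le hS h he.2)
        (size_eval_le hS h he.1) (size_eval_le hS h he.2)
      simp only [cost, leaves]
      refine le_trans ?_ this
      nlinarith [Nat.zero_le ((a.eval μ).size * (b.eval μ).size)]
  | mul a b, he => cost_node hS a.leaves_pos b.leaves_pos (cost_le hS h he.1) (cost_le hS h he.2)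
        (size_eval_le hS h he.1) (size_eval_le hS h he.2)
  | div a b, he => cost_node hS a.leaves_pos b.leaves_pos (cost_le hS h he.1) (cost_le hS h he.2)
        (size_eval_le hS h he.1) (size_eval_le hS h he.2)
  | mod a b, he => cost_node hS a.leaves_pos b.leaves_pos (cost_le hS h he.1) (cost_le hS h he.2)
        (size_eval_le hS h he.1) (size_eval_le hS h he.2)

/-- With at most `32 = 2 ^ 5` leaves the factor is `8 * 32 ^ 3 = 2 ^ 18`. The cost unit `2 ^ 20 * S
^ 2` in `Run` leaves room for the surcharges of `store`, `emit` and loop tests. -/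
theorem cost_le_of_leaves {c S : ℕ} {μ : ℕ → ℕ} (hS : 10 ≤ S) (h : ∀ i < c, (μ i).size ≤ S)
    {e : RExpr} (he : e.Reads c) (hl : e.leaves ≤ 32) : e.cost μ ≤ 2 ^ 18 * S ^ 2 :=
  (cost_le hS h he).trans <| Nat.mul_le_mul_right _ <|
    (Nat.mul_le_mul_left 8 (Nat.pow_le_pow_left hl 3)).trans (by norm_num)

end RExpr

/-! ### A program logic for lists of cells -/

/-- The values in the list `L` have bit length at most `S`. -/
def Fits (S : ℕ) (L : List ℕ) : Prop := ∀ v ∈ L, v.size ≤ S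

/-- The memory starts with the list `L`. -/
def Agrees (L : List ℕ) (μ : ℕ → ℕ) : Prop := ∀ i < L.length, μ i = L.getD i 0

/-- From every memory that starts with `L`, the program `p` leads to one that starts with `L'`, and
outputs `o`, at a cost of at most `T` units; all values in the lists have bit length at most `S`. -/
def Run (S : ℕ) (L : List ℕ) (p : RProg) (L' o : List ℕ) (T : ℕ) : Prop :=
  Fits S L → Fits S L' ∧ ∀ μ, Agrees L μ → ∀ out, ∃ μ' T',
    RExec p ⟨μ, out⟩ ⟨μ', out ++ o⟩ T' ∧ T' ≤ T * (2 ^ 20 * S ^ 2) ∧ Agrees L' μ'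

theorem Fits.getD {S : ℕ} {L : List ℕ} (h : Fits S L) (i : ℕ) : (L.getD i 0).size ≤ S := by
  by_cases hi : i < L.length
  · rw [List.getD_eq_getElem _ _ hi]; exact h _ (List.getElem_mem hi)
  · rw [List.getD_eq_default _ _ (by omega)]; simp

theorem Agrees.size_le {S : ℕ} {L : List ℕ} {μ : ℕ → ℕ} (h : Agrees L μ) (hL : Fits S L) :
    ∀ i < L.length, (μ i).size ≤ S := fun i hi => by rw [h i hi]; exact hL.getD i

theorem fits_append {S : ℕ} {L M : List ℕ} : Fits S (L ++ M) ↔ Fits S L ∧ Fits S M := by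
  simp only [Fits, List.mem_append]
  exact ⟨fun h => ⟨fun v hv => h v (.inl hv), fun v hv => h v (.inr hv)⟩,
    fun h v hv => hv.elim (h.1 v) (h.2 v)⟩

theorem fits_singleton {S v : ℕ} : Fits S [v] ↔ v.size ≤ S := by simp [Fits]

namespace Run

variable {S T T₁ T₂ c a : ℕ} {L L' L₁ L₂ o o₁ o₂ : List ℕ} {p q : RProg} {e : RExpr}

theorem mono (h : Run S L p L' o T₁) (hT : T₁ ≤ T) : Run S L p L' o T := fun hL => by
  obtain ⟨h1, h2⟩ := h hL
  refine ⟨h1, fun μ hμ out => ?_⟩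
  obtain ⟨μ', T', h3, h4, h5⟩ := h2 μ hμ out
  exact ⟨μ', T', h3, h4.trans (Nat.mul_le_mul_right _ hT), h5⟩

/-- Forgets trailing cells; this is how scratch cells are released. -/
theorem take (h : Run S L p (L' ++ L₁) o T) : Run S L p L' o T := fun hL => by
  obtain ⟨h1, h2⟩ := h hL
  refine ⟨(fits_append.1 h1).1, fun μ hμ out => ?_⟩
  obtain ⟨μ', T', h3, h4, h5⟩ := h2 μ hμ out
  refine ⟨μ', T', h3, h4, fun i hi => ?_⟩
  rw [h5 i (by simp; omega), List.getD_append _ _ _ _ hi]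

theorem seq (h₁ : Run S L p L₁ o₁ T₁) (h₂ : Run S L₁ q L₂ o₂ T₂) :
    Run S L (.seq p q) L₂ (o₁ ++ o₂) (T₁ + T₂) := fun hL => by
  obtain ⟨f1, r1⟩ := h₁ hL
  obtain ⟨f2, r2⟩ := h₂ f1
  refine ⟨f2, fun μ hμ out => ?_⟩
  obtain ⟨μ₁, t₁, e1, b1, a1⟩ := r1 μ hμ out
  obtain ⟨μ₂, t₂, e2, b2, a2⟩ := r2 μ₁ a1 (out ++ o₁)
  refine ⟨μ₂, t₁ + t₂, ?_, by rw [add_mul]; omega, a2⟩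
  rw [← List.append_assoc]
  exact .seq e1 e2

/-- Sequencing when the first program outputs nothing. -/
theorem andThen (h₁ : Run S L p L₁ [] T₁) (h₂ : Run S L₁ q L₂ o T₂) :
    Run S L (.seq p q) L₂ o (T₁ + T₂) := h₁.seq h₂

theorem emit {v : ℕ} (hS : 10 ≤ S) (he : e.Reads L.length) (hl : e.leaves ≤ 32)
    (hv : e.eval (fun i => L.getD i 0) = v) : Run S L (.emit e) L [v] 1 := fun hL => by
  refine ⟨hL, fun μ hμ out => ?_⟩
  have h0 := RExec.emit e ⟨μ, out⟩
  rw [RExpr.eval_congr hμ he, hv] at h0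
  refine ⟨μ, _, h0, ?_, hμ⟩
  · have h1 := RExpr.cost_le_of_leaves hS (hμ.size_le hL) he hl
    have h2 := RExpr.size_eval_le hS (hμ.size_le hL) he
    rw [RExpr.eval_congr hμ he, hv] at h2
    have h3 := h2.trans (Nat.mul_le_mul_right S hl)
    nlinarith

theorem store_aux {v : ℕ} (hS : 10 ≤ S) (he : e.Reads L.length) (hl : e.leaves ≤ 32)
    (hv : e.eval (fun i => L.getD i 0) = v) (ha : a < 1024) (hL : Fits S L)
    {μ : ℕ → ℕ} (hμ : Agrees L μ) (out : List ℕ) :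
    ∃ T', RExec (.store (.const a) e) ⟨μ, out⟩ ⟨Function.update μ a v, out⟩ T' ∧
      T' ≤ 1 * (2 ^ 20 * S ^ 2) := by
  have h := RExec.store (.const a) e ⟨μ, out⟩
  rw [RExpr.eval_congr hμ he, hv] at h
  refine ⟨_, h, ?_⟩
  · have h0 := RExpr.size_small hS ha
    have h1 := RExpr.cost_le_of_leaves hS (hμ.size_le hL) he hl
    have h2 := RExpr.size_eval_le hS (hμ.size_le hL) he
    rw [RExpr.eval_congr hμ he, hv] at h2
    have h3 := h2.trans (Nat.mul_le_mul_right S hl)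
    simp only [RExpr.cost, RExpr.eval]
    nlinarith

theorem push {v : ℕ} (hS : 10 ≤ S) (he : e.Reads L.length) (hl : e.leaves ≤ 32)
    (hv : e.eval (fun i => L.getD i 0) = v) (hc : c = L.length) (hc' : c < 1024)
    (hvS : v.size ≤ S) : Run S L (.store (.const c) e) (L ++ [v]) [] 1 := fun hL => by
  refine ⟨fits_append.2 ⟨hL, fits_singleton.2 hvS⟩, fun μ hμ out => ?_⟩
  obtain ⟨T', h1, h2⟩ := store_aux hS he hl hv hc' hL hμ out
  refine ⟨_, T', by simpa using h1, h2, fun i hi => ?_⟩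
  simp only [List.length_append, List.length_singleton] at hi
  rcases (by omega : i < L.length ∨ i = L.length) with h | h
  · rw [Function.update_of_ne (by omega), hμ i h, List.getD_append _ _ _ _ h]
  · subst h hc; simp

theorem set {v : ℕ} (hS : 10 ≤ S) (he : e.Reads L.length) (hl : e.leaves ≤ 32)
    (hv : e.eval (fun i => L.getD i 0) = v) (hc' : c < 1024)
    (hvS : v.size ≤ S) : Run S L (.store (.const c) e) (L.set c v) [] 1 := fun hL => by
  refine ⟨fun x hx => (List.mem_or_eq_of_mem_set hx).elim (hL x) (fun h => h ▸ hvS),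
    fun μ hμ out => ?_⟩
  obtain ⟨T', h1, h2⟩ := store_aux hS he hl hv hc' hL hμ out
  refine ⟨_, T', by simpa using h1, h2, fun i hi => ?_⟩
  rw [List.length_set] at hi
  rw [List.getD_eq_getElem _ _ (by simpa using hi), List.getElem_set]
  by_cases h : c = i
  · subst h; simp
  · rw [Function.update_of_ne (by omega), hμ i hi, List.getD_eq_getElem _ _ hi, if_neg h]

end Run

/-- The loop that runs `p` with the counter in cell `c` ranging over the numbers below the content
of cell `b`. -/
def forLoop (c b : ℕ) (p : RProg) : RProg :=
  .seq (.store (.const c) (.const 0))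
    (.loop (.sub (.mem (.const b)) (.mem (.const c)))
      (.seq p (.store (.const c) (.add (.mem (.const c)) (.const 1)))))

/-- Induction on the number `j` of remaining iterations. The counter lives in the cell just after
the list, and the truncated difference tested by the loop is nonzero exactly while the counter is
below `m`. -/
theorem Run.loop_aux {S T M m b c : ℕ} {L : ℕ → List ℕ} {o : ℕ → List ℕ} {p : RProg} (hS : 10 ≤ S)
    (hc : ∀ i ≤ m, (L i).length = c) (hc' : c < 1024) (hb : b < c)
    (hm : ∀ i ≤ m, (L i).getD b 0 = m) (hM : m ≤ M)
    (h : ∀ i < m, Run S (L i ++ [i]) p (L (i + 1) ++ [i]) (o i) T) :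
    ∀ j i, i + j = m → Run S (L i ++ [i])
      (.loop (.sub (.mem (.const b)) (.mem (.const c)))
        (.seq p (.store (.const c) (.add (.mem (.const c)) (.const 1)))))
      (L m) ((List.range' i j).flatMap o) (j * (T + 2) + 1) := by
  -- The counter never exceeds `m`, which is itself stored in cell `b`, so it needs no separate size
  -- hypothesis.
  have hfit : ∀ i ≤ m, Fits S (L i) → i.size ≤ S := fun i hi hL =>
    (Nat.size_le_size hi).trans (hm i hi ▸ hL.getD b)
  have hread : ∀ i ≤ m, (RExpr.sub (.mem (.const b)) (.mem (.const c))).Reads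
      (L i ++ [i]).length := fun i hi => by
    simp only [RExpr.Reads, List.length_append, List.length_singleton, hc i hi]; omega
  have heval : ∀ i ≤ m, ∀ μ, Agrees (L i ++ [i]) μ →
      (RExpr.sub (.mem (.const b)) (.mem (.const c))).eval μ = m - i := fun i hi μ hμ => by
    rw [RExpr.eval_congr hμ (hread i hi)]
    simp only [RExpr.eval]
    rw [List.getD_append _ _ _ _ (by rw [hc i hi]; exact hb), hm i hi, ← hc i hi]
    simp
  have hcost : ∀ i ≤ m, Fits S (L i ++ [i]) → ∀ μ, Agrees (L i ++ [i]) μ →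
      (RExpr.sub (.mem (.const b)) (.mem (.const c))).cost μ + 1 ≤ 1 * (2 ^ 20 * S ^ 2) :=
    fun i hi hL μ hμ => by
      have := RExpr.cost_le_of_leaves hS (hμ.size_le hL) (hread i hi) (by simp [RExpr.leaves])
      nlinarith
  intro j
  induction j with
  | zero =>
    intro i hi hL
    obtain rfl : i = m := by omega
    refine ⟨(fits_append.1 hL).1, fun μ hμ out => ?_⟩
    have h0 := RExec.loop_stop (e := .sub (.mem (.const b)) (.mem (.const c)))
      (p := .seq p (.store (.const c) (.add (.mem (.const c)) (.const 1)))) (s := ⟨μ, out⟩)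
      (by rw [heval i le_rfl μ hμ]; omega)
    refine ⟨μ, _, by simpa using h0, ?_, fun x hx => ?_⟩
    · simpa using hcost i le_rfl hL μ hμ
    · rw [hμ x (by simp; omega), List.getD_append _ _ _ _ hx]
  | succ j ih =>
    intro i hi hL
    have hinc : Run S (L (i + 1) ++ [i])
        (.store (.const c) (.add (.mem (.const c)) (.const 1))) (L (i + 1) ++ [i + 1]) [] 1 := by
      intro hL'
      have := Run.set (S := S) (L := L (i + 1) ++ [i]) (c := c) (v := i + 1)
        (e := .add (.mem (.const c)) (.const 1)) hS
        (by simp only [RExpr.Reads, List.length_append, List.length_singleton,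
              hc (i + 1) (by omega)]; omega)
        (by simp [RExpr.leaves])
        (by simp only [RExpr.eval]; rw [← hc (i + 1) (by omega)]; simp) hc'
        (hfit _ (by omega) (fits_append.1 hL').1)
      rw [← hc (i + 1) (by omega)] at this
      rw [← hc (i + 1) (by omega)]
      simpa using this hL'
    obtain ⟨f1, r1⟩ := ((h i (by omega)).seq hinc) hL
    obtain ⟨f2, r2⟩ := ih (i + 1) (by omega) f1
    refine ⟨f2, fun μ hμ out => ?_⟩
    obtain ⟨μ₁, t₁, e1, b1, a1⟩ := r1 μ hμ out
    obtain ⟨μ₂, t₂, e2, b2, a2⟩ := r2 μ₁ a1 (out ++ o i)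
    have hk := hcost i (by omega) hL μ hμ
    rw [List.append_nil] at e1
    have h0 := RExec.loop_step (e := .sub (.mem (.const b)) (.mem (.const c)))
      (by rw [heval i (by omega) μ hμ]; omega) e1 e2
    rw [List.append_assoc, ← List.flatMap_cons (f := o), ← List.range'_succ] at h0
    refine ⟨μ₂, _, h0, ?_, a2⟩
    dsimp only
    nlinarith

/-- The rule for loops: `L i` is the list of cells before the `i`-th iteration. -/
theorem Run.forLoop {S T M m b c : ℕ} (L : ℕ → List ℕ) {o : ℕ → List ℕ} {p : RProg} (hS : 10 ≤ S)
    (hc : ∀ i ≤ m, (L i).length = c) (hc' : c < 1024) (hb : b < c)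
    (hm : ∀ i ≤ m, (L i).getD b 0 = m) (hM : m ≤ M)
    (h : ∀ i < m, Run S (L i ++ [i]) p (L (i + 1) ++ [i]) (o i) T) :
    Run S (L 0) (forLoop c b p) (L m) ((List.range m).flatMap o) ((M + 1) * (T + 2)) := by
  have h0 : Run S (L 0) (.store (.const c) (.const 0)) (L 0 ++ [0]) [] 1 :=
    Run.push hS (by simp [RExpr.Reads]) (by simp [RExpr.leaves]) rfl (hc 0 (by omega)).symm hc'
      (by simp)
  have h1 := Run.loop_aux hS hc hc' hb hm hM h m 0 (by omega)
  rw [← List.range_eq_range'] at h1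
  exact (h0.andThen h1).mono (by nlinarith)

end GenABPHitting

namespace GenABPHitting

/-- The rule for loops without output. -/
theorem Run.forLoop_silent {S T M m b c : ℕ} (L : ℕ → List ℕ) {p : RProg} (hS : 10 ≤ S)
    (hc : ∀ i ≤ m, (L i).length = c) (hc' : c < 1024) (hb : b < c)
    (hm : ∀ i ≤ m, (L i).getD b 0 = m) (hM : m ≤ M)
    (h : ∀ i < m, Run S (L i ++ [i]) p (L (i + 1) ++ [i]) [] T) :
    Run S (L 0) (GenABPHitting.forLoop c b p) (L m) [] ((M + 1) * (T + 2)) := by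
  have := Run.forLoop (o := fun _ => []) L hS hc hc' hb hm hM h
  rwa [List.flatMap_eq_nil_iff.2 (fun _ _ => rfl)] at this

/-- The power of the content of cell `b` to the content of cell `e`, computed in cell `c`. -/
def powProg (c b e : ℕ) : RProg :=
  .seq (.store (.const c) (.const 1))
    (forLoop (c + 1) e (.store (.const c) (.mul (.mem (.const c)) (.mem (.const b)))))

theorem Run.pow {S M b c e x m : ℕ} {L : List ℕ} (hS : 10 ≤ S) (hc : L.length = c)
    (hc' : c < 1000) (hb : b < c) (he : e < c) (hx : L.getD b 0 = x) (hm : L.getD e 0 = m)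
    (hM : m ≤ M) (hfit : ∀ i ≤ m, (x ^ i).size ≤ S) :
    Run S L (powProg c b e) (L ++ [x ^ m]) [] (1 + (M + 1) * 3) := by
  refine (Run.push (v := x ^ 0) hS (by simp [RExpr.Reads]) (by simp [RExpr.leaves]) rfl hc.symm
    (by omega) (hfit 0 (by omega))).andThen ?_
  refine Run.forLoop_silent (fun i => L ++ [x ^ i]) hS (fun i _ => by simp [hc]) (by omega)
    (by omega) (fun i _ => ?_) hM (fun i hi => ?_)
  · rw [List.getD_append _ _ _ _ (by omega), hm]
  · have := Run.set (S := S) (L := L ++ [x ^ i] ++ [i]) (c := c) (v := x ^ (i + 1))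
      (e := .mul (.mem (.const c)) (.mem (.const b))) hS
      (by simp only [RExpr.Reads, List.length_append, List.length_singleton]; omega)
      (by simp [RExpr.leaves])
      (by
        simp only [RExpr.eval, List.append_assoc]
        rw [List.getD_append _ _ _ b (by omega), hx, List.getD_append_right _ _ _ _ (by omega)]
        simp [hc, pow_succ]) (by omega) (hfit _ (by omega))
    convert this using 1
    simp [hc]

/-! ### The program -/

/-- One round of the weight computation: from the remaining choice number `s.1` two digits to base
`Q` are split off, and the weight `s.2` is refined. -/
def weightStep (Q B v τ : ℕ) (s : ℕ × ℕ) : ℕ × ℕ :=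
  (s.1 / Q / Q, s.2 * B + v * (s.1 / Q % Q) ^ τ % (s.1 % Q + 1))

/-- The coefficient of the variable with number `v` at position `τ`, for the choice number `g`. -/
def choiceCoeff (Q B Λ g v τ : ℕ) : ℕ :=
  ((weightStep Q B v τ)^[Λ] (g, v)).1 ^ ((weightStep Q B v τ)^[Λ] (g, v)).2

/-- The input size parameter. -/
def paramP (n ℓ r d : ℕ) : ℕ := n * r * d * ℓ + 1

/-- The range of the digits of choice numbers. -/
def paramQ (P : ℕ) : ℕ := 2 * P ^ 12

/-- The base of the weights. -/
def paramB (P : ℕ) : ℕ := P * paramQ P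

/-- The number of choices. -/
def paramG (P Λ : ℕ) : ℕ := P ^ 2 * (paramQ P * paramQ P * paramB P) ^ Λ

/-- The number of the variable `(x, a, b)` with `a, b < ℓ`. -/
def varCode (ℓ x a b : ℕ) : ℕ := (x * ℓ + a) * ℓ + b

/-- The output for one term of one entry. -/
def termOut (ℓ d k Q B Λ g x i j i' j' a : ℕ) : List ℕ :=
  [0, (1 - ((j' - (j + 1) % d) + ((j + 1) % d - j'))) *
      choiceCoeff Q B Λ g (varCode ℓ x a ((i' + ℓ - i) % ℓ)) j, a * k ^ i, 1 - (1 - (i - i'))]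

/-- The output for one point. -/
def pointOut (n ℓ d k Q B Λ g : ℕ) : List ℕ :=
  (List.range n).flatMap fun x => (List.range ℓ).flatMap fun i => (List.range d).flatMap fun j =>
    (List.range ℓ).flatMap fun i' => (List.range d).flatMap fun j' =>
      ℓ :: (List.range ℓ).flatMap fun a => termOut ℓ d k Q B Λ g x i j i' j' a

namespace RExpr

/-- The content of a cell with fixed address. -/
abbrev cell (a : ℕ) : RExpr := mem (const a)

/-- Repeated multiplication by the content of a cell. -/
def mulPow (e : RExpr) (a : ℕ) : ℕ → RExpr
  | 0 => e
  | m + 1 => mul (mulPow e a m) (cell a)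

end RExpr

open RExpr RProg

/-- Computes and emits one term. -/
def termProg : RProg :=
  .seq (.store (.const 19) (.add (.mul (.add (.mul (cell 12) (cell 1)) (cell 18)) (cell 1))
    (.mod (.sub (.add (cell 16) (cell 1)) (cell 13)) (cell 1)))) <|
  .seq (.store (.const 20) (cell 11)) <|
  .seq (.store (.const 21) (cell 19)) <|
  .seq (forLoop 22 9 <|
    .seq (.store (.const 23) (.mod (.div (cell 20) (cell 7)) (cell 7))) <|
    .seq (powProg 24 23 15) <|
    .seq (.store (.const 21) (.add (.mul (cell 21) (cell 8))
      (.mod (.mul (cell 19) (cell 24)) (.add (.mod (cell 20) (cell 7)) (.const 1))))) <|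
    .store (.const 20) (.div (.div (cell 20) (cell 7)) (cell 7))) <|
  .seq (powProg 22 20 21) <|
  .seq (.emit (.const 0)) <|
  .seq (.emit (.mul (.sub (.const 1) (.add
      (.sub (cell 17) (.mod (.add (cell 15) (.const 1)) (cell 3)))
      (.sub (.mod (.add (cell 15) (.const 1)) (cell 3)) (cell 17)))) (cell 22))) <|
  .seq (.emit (.mul (cell 18) (cell 14))) <|
  .emit (.sub (.const 1) (.sub (.const 1) (.sub (cell 13) (cell 16))))

/-- Emits all points, once the parameters are computed. -/
def pointsProg : RProg :=
  forLoop 11 10 <| forLoop 12 0 <| forLoop 13 1 <| .seq (powProg 14 5 13) <| forLoop 15 3 <|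
    forLoop 16 1 <| forLoop 17 3 <| .seq (.emit (cell 1)) <| forLoop 18 1 termProg

/-- Computes the parameters. -/
def paramProg : RProg :=
  .seq (.store (.const 6) (.add (.mul (.mul (.mul (cell 0) (cell 2)) (cell 3)) (cell 1))
    (.const 1))) <|
  .seq (.store (.const 7) (mulPow (.const 2) 6 12)) <|
  .seq (.store (.const 8) (.mul (cell 6) (cell 7))) <|
  .seq (.store (.const 9) (.const 0)) <|
  .seq (.store (.const 10) (cell 3)) <|
  .seq (forLoop 11 3 <|
    .seq (.store (.const 9) (.add (cell 9) (.sub (.const 1) (.sub (.const 1) (cell 10))))) <|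
    .store (.const 10) (.div (cell 10) (.const 2))) <|
  .seq (.store (.const 10) (.mul (cell 6) (cell 6))) <|
  forLoop 11 9 <|
    .store (.const 10) (.mul (cell 10) (.mul (.mul (cell 7) (cell 7)) (cell 8)))

/-- The program that emits the hitting set. -/
def hittingProg : RProg := .seq paramProg pointsProg

/-! ### Correctness and cost of the program -/

theorem varCode_lt {n ℓ x a b : ℕ} (hx : x < n) (ha : a < ℓ) (hb : b < ℓ) :
    varCode ℓ x a b < n * ℓ * ℓ := by
  unfold varCode
  have h1 : x * ℓ + a + 1 ≤ n * ℓ := by nlinarith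
  nlinarith

theorem weightStep_iterate_fst_le (Q B v τ g i : ℕ) :
    ((weightStep Q B v τ)^[i] (g, v)).1 ≤ g := by
  induction i with
  | zero => simp
  | succ i ih =>
    rw [Function.iterate_succ_apply']
    exact ((Nat.div_le_self _ _).trans (Nat.div_le_self _ _)).trans ih

/-- In base `B` the weight has the leading part `v < m`, and each round appends one digit, which is
below `Q ≤ B`. -/
theorem weightStep_iterate_snd_lt {Q B v τ g m : ℕ} (hv : v < m) (hQ : 0 < Q) (hB : Q ≤ B)
    (i : ℕ) : ((weightStep Q B v τ)^[i] (g, v)).2 < m * B ^ i := by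
  induction i with
  | zero => simpa using hv
  | succ i ih =>
    rw [Function.iterate_succ_apply']
    set s := (weightStep Q B v τ)^[i] (g, v)
    have h1 : v * (s.1 / Q % Q) ^ τ % (s.1 % Q + 1) < s.1 % Q + 1 :=
      Nat.mod_lt _ (Nat.succ_pos _)
    have h2 := Nat.mod_lt s.1 hQ
    have h3 : (s.2 + 1) * B ≤ m * B ^ i * B := Nat.mul_le_mul_right _ ih
    simp only [weightStep, pow_succ]
    rw [← mul_assoc]
    have : v * (s.1 / Q % Q) ^ τ % (s.1 % Q + 1) < B := by omega
    nlinarith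

theorem size_le_self (x : ℕ) : x.size ≤ x := Nat.size_le.2 Nat.lt_two_pow_self

/-- The origin of the word length `M * M + 1`: the largest values that occur are powers with
exponent at most `M` of numbers of bit length at most `M`. -/
theorem size_pow_le {x m M : ℕ} (hx : x.size ≤ M) (hm : m ≤ M) : (x ^ m).size ≤ M * M + 1 := by
  rw [Nat.size_le] at *
  calc x ^ m ≤ (2 ^ M) ^ m := Nat.pow_le_pow_left hx.le m
    _ = 2 ^ (M * m) := (pow_mul _ _ _).symm
    _ ≤ 2 ^ (M * M) := Nat.pow_le_pow_right (by norm_num) (Nat.mul_le_mul_left _ hm)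
    _ < 2 ^ (M * M + 1) := Nat.pow_lt_pow_right (by norm_num) (by omega)

theorem termProg_run {M n ℓ r d N k P Q B Λ G g x i ki j i' j' a : ℕ} (hM : 3 ≤ M)
    (hki : ki = k ^ i) (hx : x < n) (hj : j < d) (ha : a < ℓ)
    (hQ : 0 < Q) (hB : Q ≤ B) (hd : d ≤ M) (hΛ : Λ ≤ M) (hg : g ≤ M)
    (hw : ∀ i ≤ Λ, n * ℓ * ℓ * B ^ i ≤ M) :
    Run (M * M + 1) [n, ℓ, r, d, N, k, P, Q, B, Λ, G, g, x, i, ki, j, i', j', a] termProg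
      [n, ℓ, r, d, N, k, P, Q, B, Λ, G, g, x, i, ki, j, i', j', a]
      (termOut ℓ d k Q B Λ g x i j i' j' a)
      (10 + (M + 1) * 3 + (M + 1) * (10 + (M + 1) * 3)) := by
  have hS : 10 ≤ M * M + 1 := by nlinarith
  have hMS : ∀ {x : ℕ}, x ≤ M → x.size ≤ M * M + 1 := fun h =>
    ((size_le_self _).trans h).trans (by nlinarith)
  subst hki
  set v := varCode ℓ x a ((i' + ℓ - i) % ℓ) with hv
  have hvlt : v < n * ℓ * ℓ := varCode_lt hx ha (Nat.mod_lt _ (by omega))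
  have hvM : v ≤ M := hvlt.le.trans (by simpa using hw 0 (by omega))
  -- The loop invariant: after `t` rounds the cells 20 and 21 hold the two components of `st t`.
  let st : ℕ → ℕ × ℕ := fun t => (weightStep Q B v j)^[t] (g, v)
  have hst1 : ∀ t, (st t).1 ≤ M := fun t => (weightStep_iterate_fst_le ..).trans hg
  have hst2 : ∀ t ≤ Λ, (st t).2 ≤ M := fun t ht =>
    (weightStep_iterate_snd_lt hvlt hQ hB t).le.trans (hw t ht)
  have key : Run (M * M + 1) [n, ℓ, r, d, N, k, P, Q, B, Λ, G, g, x, i, k ^ i, j, i', j', a] termProg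
      ([n, ℓ, r, d, N, k, P, Q, B, Λ, G, g, x, i, k ^ i, j, i', j', a] ++
        [v, (st Λ).1, (st Λ).2, (st Λ).1 ^ (st Λ).2])
      (termOut ℓ d k Q B Λ g x i j i' j' a)
      (1 + (1 + (1 + ((M + 1) * ((1 + ((1 + (M + 1) * 3) + (1 + 1))) + 2) +
        ((1 + (M + 1) * 3) + (1 + (1 + (1 + 1)))))))) := by
    unfold termProg
    refine (Run.push (v := v) hS ?_ ?_ ?_ rfl ?_ (hMS hvM)).andThen ?_
    · simp [Reads]
    · simp [leaves]
    · simp [eval, hv, varCode]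
    · norm_num
    refine (Run.push (v := g) hS ?_ ?_ ?_ rfl ?_ (hMS hg)).andThen ?_
    · simp [Reads]
    · simp [leaves]
    · simp [eval]
    · norm_num
    refine (Run.push (v := v) hS ?_ ?_ ?_ rfl ?_ (hMS hvM)).andThen ?_
    · simp [Reads]
    · simp [leaves]
    · simp [eval]
    · norm_num
    refine (Run.forLoop_silent (M := M) (m := Λ) (T := (1 + ((1 + (M + 1) * 3) + (1 + 1))))
      (fun t => [n, ℓ, r, d, N, k, P, Q, B, Λ, G, g, x, i, k ^ i, j, i', j', a] ++
        [v, (st t).1, (st t).2]) hS (fun _ _ => rfl) (by norm_num) (by norm_num) (fun _ _ => rfl) hΛ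
        (fun t ht => ?_)).andThen ?_
    -- Cells 23 and 24 are scratch: the digit `α` and its power `α ^ j`.
    · refine Run.take (L₁ := [(st t).1 / Q % Q, ((st t).1 / Q % Q) ^ j]) ?_
      have hα : (st t).1 / Q % Q ≤ M :=
        ((Nat.mod_le _ _).trans (Nat.div_le_self _ _)).trans (hst1 t)
      refine (Run.push (v := (st t).1 / Q % Q) hS ?_ ?_ ?_ rfl ?_ (hMS hα)).andThen ?_
      · simp [Reads]
      · simp [leaves]
      · simp [eval]
      · norm_num
      refine (Run.pow (M := M) (x := (st t).1 / Q % Q) (m := j) hS rfl ?_ ?_ ?_ rfl rfl (by omega)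
        ?_).andThen ?_
      · norm_num
      · norm_num
      · norm_num
      · exact fun i hi => size_pow_le ((size_le_self _).trans hα) (by omega)
      -- The weight is updated before the choice number is shortened, because the modulus is read
      -- off from the old choice number.
      refine (Run.set (v := (st (t + 1)).2) hS ?_ ?_ ?_ ?_ (hMS (hst2 _ ht))).andThen ?_
      · simp [Reads]
      · simp [leaves]
      · simp only [st, Function.iterate_succ_apply', weightStep]; simp [eval]
      · norm_num
      refine Run.set (v := (st (t + 1)).1) hS ?_ ?_ ?_ ?_ (hMS (hst1 _))
      · simp [Reads]
      · simp [leaves]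
      · simp only [st, Function.iterate_succ_apply', weightStep]; simp [eval]
      · norm_num
    refine (Run.pow (M := M) (x := (st Λ).1) (m := (st Λ).2) hS rfl ?_ ?_ ?_ rfl rfl
      (hst2 _ le_rfl) ?_).andThen ?_
    · norm_num
    · norm_num
    · norm_num
    · exact fun i hi => size_pow_le ((size_le_self _).trans (hst1 _)) (hi.trans (hst2 _ le_rfl))
    refine Run.seq (o₁ := [_]) (o₂ := [_, _, _])
      (Run.emit hS (by simp [Reads]) (by simp [leaves]) (by simp [eval])) ?_
    refine Run.seq (o₁ := [_]) (o₂ := [_, _])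
      (Run.emit hS (by simp [Reads]) (by simp [leaves]) ?_) ?_
    · simp [eval, choiceCoeff, st, hv]
    refine Run.seq (o₁ := [_]) (o₂ := [_])
      (Run.emit hS (by simp [Reads]) (by simp [leaves]) (by simp [eval])) ?_
    exact Run.emit hS (by simp [Reads]) (by simp [leaves]) (by simp [eval])
  refine key.take.mono ?_
  ring_nf
  omega

end GenABPHitting

namespace GenABPHitting

open RExpr RProg

/-- The ninth power counts nested loops: seven over the point, its entries and their terms, one over
the rounds of the weight computation, and one for the power computed in each round. -/
theorem pointsProg_run {M n ℓ r d N k P Q B Λ G : ℕ} (hM : 3 ≤ M)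
    (hQ : 0 < Q) (hB : Q ≤ B) (hn : n ≤ M) (hℓ : ℓ ≤ M) (hk : k.size ≤ M)
    (hd : d ≤ M) (hΛ : Λ ≤ M) (hG : G ≤ M) (hw : ∀ i ≤ Λ, n * ℓ * ℓ * B ^ i ≤ M) :
    Run (M * M + 1) [n, ℓ, r, d, N, k, P, Q, B, Λ, G] pointsProg
      [n, ℓ, r, d, N, k, P, Q, B, Λ, G]
      ((List.range G).flatMap (pointOut n ℓ d k Q B Λ)) (200 * (M + 1) ^ 9) := by
  have hS : 10 ≤ M * M + 1 := by nlinarith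
  have key : Run (M * M + 1) [n, ℓ, r, d, N, k, P, Q, B, Λ, G] pointsProg
      [n, ℓ, r, d, N, k, P, Q, B, Λ, G]
      ((List.range G).flatMap (pointOut n ℓ d k Q B Λ))
      ((M + 1) * ((M + 1) * ((M + 1) * ((1 + (M + 1) * 3) + (M + 1) * ((M + 1) * ((M + 1) *
        (1 + (M + 1) * ((10 + (M + 1) * 3 + (M + 1) * (10 + (M + 1) * 3)) + 2) + 2)
        + 2) + 2) + 2) + 2) + 2)) := by
    refine Run.forLoop (fun _ => _) hS (fun _ _ => rfl) (by norm_num) (by norm_num)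
      (fun _ _ => rfl) hG fun g hg => ?_
    refine Run.forLoop (fun _ => _) hS (fun _ _ => rfl) (by norm_num) (by norm_num)
      (fun _ _ => rfl) hn fun x hx => ?_
    refine Run.forLoop (fun _ => _) hS (fun _ _ => rfl) (by norm_num) (by norm_num)
      (fun _ _ => rfl) hℓ fun i hi => ?_
    refine Run.take (L₁ := [k ^ i]) ?_
    refine (Run.pow (M := M) (x := k) (m := i) hS rfl (by norm_num) (by norm_num) (by norm_num)
      rfl rfl (by omega) (fun j hj => size_pow_le hk (by omega))).andThen ?_
    refine Run.forLoop (fun _ => _) hS (fun _ _ => rfl) (by norm_num) (by norm_num)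
      (fun _ _ => rfl) hd fun j hj => ?_
    refine Run.forLoop (fun _ => _) hS (fun _ _ => rfl) (by norm_num) (by norm_num)
      (fun _ _ => rfl) hℓ fun i' hi' => ?_
    refine Run.forLoop (fun _ => _) hS (fun _ _ => rfl) (by norm_num) (by norm_num)
      (fun _ _ => rfl) hd fun j' hj' => ?_
    refine Run.seq (o₁ := [ℓ])
      (Run.emit hS (by simp [Reads]) (by simp [leaves]) (by simp [eval])) ?_
    refine Run.forLoop (fun _ => _) hS (fun _ _ => rfl) (by norm_num) (by norm_num)
      (fun _ _ => rfl) hℓ fun a ha => ?_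
    exact termProg_run hM rfl hx hj ha hQ hB hd hΛ (by omega) hw
  refine key.mono ?_
  ring_nf
  omega

/-- The expression `1 - (1 - y)` is the indicator of `y ≠ 0`, so counting the nonzero numbers `d / 2
^ i` yields the bit length of `d`. -/
theorem halving_step (d i : ℕ) :
    min i d.size + (1 - (1 - d / 2 ^ i)) = min (i + 1) d.size := by
  rcases lt_or_ge i d.size with h | h
  · have : 0 < d / 2 ^ i := Nat.div_pos (Nat.lt_size.1 h) (by positivity)
    omega
  · have : d / 2 ^ i = 0 := Nat.div_eq_of_lt (Nat.size_le.1 h)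
    omega

theorem paramProg_run {M n ℓ r d N k : ℕ} (hM : 3 ≤ M) (hd : d ≤ M)
    (hP : paramP n ℓ r d ≤ M) (hQ : paramQ (paramP n ℓ r d) ≤ M)
    (hB : paramB (paramP n ℓ r d) ≤ M) (hG : ∀ i ≤ d.size, paramG (paramP n ℓ r d) i ≤ M) :
    Run (M * M + 1) [n, ℓ, r, d, N, k] paramProg
      [n, ℓ, r, d, N, k, paramP n ℓ r d, paramQ (paramP n ℓ r d), paramB (paramP n ℓ r d), d.size,
        paramG (paramP n ℓ r d) d.size] [] (6 + (M + 1) * 7) := by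
  have hS : 10 ≤ M * M + 1 := by nlinarith
  have hMS : ∀ {x : ℕ}, x ≤ M → x.size ≤ M * M + 1 := fun h =>
    ((size_le_self _).trans h).trans (by nlinarith)
  set P := paramP n ℓ r d with hPdef
  have hdM : d.size ≤ M := (size_le_self d).trans hd
  have key : Run (M * M + 1) [n, ℓ, r, d, N, k] paramProg
      [n, ℓ, r, d, N, k, P, paramQ P, paramB P, d.size, paramG P d.size] []
      (1 + (1 + (1 + (1 + (1 + ((M + 1) * ((1 + 1) + 2) + (1 + (M + 1) * (1 + 2)))))))) := by
    refine (Run.push (v := P) hS ?_ ?_ ?_ rfl ?_ (hMS hP)).andThen ?_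
    · simp [Reads]
    · simp [leaves]
    · simp [eval, hPdef, paramP]
    · norm_num
    refine (Run.push (v := paramQ P) hS ?_ ?_ ?_ rfl ?_ (hMS hQ)).andThen ?_
    · simp [Reads, mulPow]
    · simp [leaves, mulPow]
    · simp [eval, paramQ, mulPow]; ring
    · norm_num
    refine (Run.push (v := paramB P) hS ?_ ?_ ?_ rfl ?_ (hMS hB)).andThen ?_
    · simp [Reads]
    · simp [leaves]
    · simp [eval, paramB]
    · norm_num
    refine (Run.push (v := 0) hS ?_ ?_ ?_ rfl ?_ (by simp)).andThen ?_
    · simp [Reads]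
    · simp [leaves]
    · simp [eval]
    · norm_num
    refine (Run.push (v := d) hS ?_ ?_ ?_ rfl ?_ (hMS hd)).andThen ?_
    · simp [Reads]
    · simp [leaves]
    · simp [eval]
    · norm_num
    -- The halving loop runs `d` times, at least the bit length; the surplus rounds see the quotient
    -- `0` and leave the count unchanged.
    have loop := Run.forLoop_silent (S := M * M + 1) (M := M) (m := d) (T := 1 + 1) (b := 3) (c := 11)
      (p := .seq (.store (.const 9)
          (.add (cell 9) (.sub (.const 1) (.sub (.const 1) (cell 10))))) <|
        .store (.const 10) (.div (cell 10) (.const 2)))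
      (fun i => [n, ℓ, r, d, N, k, P, paramQ P, paramB P] ++ [min i d.size, d / 2 ^ i]) hS
      (fun _ _ => rfl) (by norm_num) (by norm_num) (fun _ _ => rfl) hd fun i hi => by
        refine (Run.set (v := min (i + 1) d.size) hS ?_ ?_ ?_ ?_
          (hMS ((min_le_right _ _).trans hdM))).andThen ?_
        · simp [Reads]
        · simp [leaves]
        · rw [← halving_step]; simp [eval]
        · norm_num
        refine Run.set (v := d / 2 ^ (i + 1)) hS ?_ ?_ ?_ ?_
          (hMS ((Nat.div_le_self _ _).trans hd))
        · simp [Reads]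
        · simp [leaves]
        · simp [eval, pow_succ, Nat.div_div_eq_div_mul]
        · norm_num
    simp only [pow_zero, Nat.div_one, Nat.zero_min, min_eq_right (size_le_self d)] at loop
    refine loop.andThen ?_
    -- Cell 10, which held the halved `d`, is reused to accumulate the number of choices.
    refine (Run.set (v := paramG P 0) hS ?_ ?_ ?_ ?_ (hMS (hG 0 (by omega)))).andThen ?_
    · simp [Reads]
    · simp [leaves]
    · simp [eval, paramG, pow_two]
    · norm_num
    refine Run.forLoop_silent (M := M) (m := d.size) (T := 1)
      (fun i => [n, ℓ, r, d, N, k, P, paramQ P, paramB P, d.size] ++ [paramG P i]) hS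
      (fun _ _ => rfl) (by norm_num) (by norm_num) (fun _ _ => rfl) hdM fun i hi => ?_
    refine Run.set (v := paramG P (i + 1)) hS ?_ ?_ ?_ ?_ (hMS (hG _ hi))
    · simp [Reads]
    · simp [leaves]
    · simp [eval, paramG, pow_succ]; ring
    · norm_num
  refine key.mono ?_
  ring_nf
  omega

end GenABPHitting

/-! ### The hitting set: encoding, size and generation -/

namespace GenABPHitting

/-- The point of the hitting set with choice number `g`. -/
def choicePoint (n ℓ d k Q B Λ g : ℕ) : SymbPoint n ℓ d := fun x u v =>
  (List.range ℓ).map fun a =>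
    ((((1 - ((v.2 - (u.2 + 1) % d) + ((u.2 + 1) % d - v.2))) *
      choiceCoeff Q B Λ g (varCode ℓ x a ((v.1 + ℓ - u.1) % ℓ)) u.2 : ℕ) : ℤ), a * k ^ (u.1 : ℕ),
      1 - (1 - ((u.1 : ℕ) - v.1)))

theorem flatMap_finRange {α : Type*} (n : ℕ) (f : ℕ → List α) :
    (List.finRange n).flatMap (fun i : Fin n => f i) = (List.range n).flatMap f := by
  rw [← List.map_coe_finRange_eq_range, List.flatMap_map]

theorem encode_choicePoint (n ℓ d k Q B Λ g : ℕ) :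
    (choicePoint n ℓ d k Q B Λ g).encode = pointOut n ℓ d k Q B Λ g := by
  have h : ∀ (x : Fin n) (u v : Fin ℓ × Fin d), Symb.encode (choicePoint n ℓ d k Q B Λ g x u v) =
      ℓ :: (List.range ℓ).flatMap fun a => termOut ℓ d k Q B Λ g x u.1 u.2 v.1 v.2 a := by
    intro x u v
    simp only [Symb.encode, choicePoint, List.length_map, List.length_range, List.flatMap_map,
      Int.natAbs_natCast, termOut]
    congr 2
  simp only [SymbPoint.encode, h, pointOut, ← flatMap_finRange]

/-- The hitting set. -/
def hittingSet (n ℓ r d k : ℕ) : List (SymbPoint n ℓ d) :=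
  (List.range (paramG (paramP n ℓ r d) d.size)).map
    (choicePoint n ℓ d k (paramQ (paramP n ℓ r d)) (paramB (paramP n ℓ r d)) d.size)

theorem encode_hittingSet (n ℓ r d k : ℕ) :
    (hittingSet n ℓ r d k).flatMap SymbPoint.encode =
      (List.range (paramG (paramP n ℓ r d) d.size)).flatMap
        (pointOut n ℓ d k (paramQ (paramP n ℓ r d)) (paramB (paramP n ℓ r d)) d.size) := by
  simp only [hittingSet, List.flatMap_map, encode_choicePoint]

/-- Since `2 ≤ P`, the digit range `Q` is at most `P ^ 13` and the base `B = P * Q` at most `P ^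
14`, so each round costs a factor `P ^ (13 + 13 + 14)`. -/
theorem paramG_le {P : ℕ} (hP : 2 ≤ P) (Λ : ℕ) : paramG P Λ ≤ P ^ (2 + 40 * Λ) := by
  have h1 : paramQ P ≤ P ^ 13 := by
    rw [paramQ, pow_succ' P 12]; exact Nat.mul_le_mul_right _ hP
  have h2 : paramQ P * paramQ P * paramB P ≤ P ^ 40 :=
    calc paramQ P * paramQ P * (P * paramQ P) ≤ P ^ 13 * P ^ 13 * (P * P ^ 13) := by gcongr
      _ = P ^ 40 := by ring
  rw [paramG, pow_add, pow_mul]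
  gcongr

theorem paramG_mono {P i j : ℕ} (hP : 2 ≤ P) (hij : i ≤ j) : paramG P i ≤ paramG P j := by
  unfold paramG
  refine Nat.mul_le_mul_left _ (Nat.pow_le_pow_right ?_ hij)
  unfold paramB paramQ
  positivity

theorem size_le_log_add_one (d : ℕ) : d.size ≤ Nat.log 2 d + 1 :=
  Nat.size_le.2 (Nat.lt_pow_succ_log_self (by norm_num) d)

theorem length_hittingSet_le {n ℓ r d : ℕ} (k : ℕ) (hn : 0 < n) (hℓ : 0 < ℓ) (hr : 0 < r)
    (hd : 0 < d) : (hittingSet n ℓ r d k).length ≤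
      (n * r * d * ℓ + 1) ^ (42 * (Nat.log 2 (n * d * ℓ) + 1)) := by
  have hP : 2 ≤ paramP n ℓ r d := by
    have : 0 < n * r * d * ℓ := by positivity
    unfold paramP; omega
  rw [hittingSet, List.length_map, List.length_range]
  refine (paramG_le hP _).trans (Nat.pow_le_pow_right (by omega) ?_)
  have h1 := size_le_log_add_one d
  have h2 : Nat.log 2 d ≤ Nat.log 2 (n * d * ℓ) := Nat.log_mono_right (by
    rw [mul_right_comm]; exact Nat.le_mul_of_pos_left _ (by positivity))
  omega

/-- All other parameters and all loop lengths are at most the number of choices, so one bound `M`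
serves throughout. For `N` and `k` only the bit length has to be bounded: they are never loop
bounds. -/
theorem hittingProg_exec {n ℓ r d N k : ℕ} (hn : 0 < n) (hℓ : 0 < ℓ) (hr : 0 < r)
    (hd : 0 < d) {M : ℕ} (hN : N.size ≤ M) (hk : k.size ≤ M)
    (hG : paramG (paramP n ℓ r d) d.size ≤ M) :
    ∃ (s : RState) (T : ℕ), RExec hittingProg (RState.init [n, ℓ, r, d, N, k]) s T ∧
      s.out = (hittingSet n ℓ r d k).flatMap SymbPoint.encode ∧
      T ≤ 300 * (M + 1) ^ 9 * (2 ^ 20 * (M * M + 1) ^ 2) := by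
  obtain ⟨P, hPdef⟩ : ∃ P, P = paramP n ℓ r d := ⟨_, rfl⟩
  rw [← hPdef] at hG
  have hpos : 0 < n * r * d * ℓ := by positivity
  have hP : 2 ≤ P := by rw [hPdef, paramP]; omega
  have hP0 : 0 < P := by omega
  have hdsize : 1 ≤ d.size := Nat.size_pos.2 hd
  -- As `d > 0` there is at least one round, so a factor `paramB P` is present in the number of
  -- choices.
  have hG1 : paramG P 1 ≤ M := (paramG_mono hP hdsize).trans hG
  have hQ0 : 0 < paramQ P := by unfold paramQ; positivity
  have hPB : paramQ P ≤ paramB P := Nat.le_mul_of_pos_left _ (by omega)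
  have hPB' : P ≤ paramB P := Nat.le_mul_of_pos_right _ hQ0
  have hB : paramB P ≤ M := by
    refine le_trans ?_ hG1
    rw [paramG, pow_one, ← mul_assoc]
    exact Nat.le_mul_of_pos_left _ (by positivity)
  have hQ : paramQ P ≤ M := hPB.trans hB
  have hPM : P ≤ M := hPB'.trans hB
  have hM : 3 ≤ M := by
    refine le_trans ?_ hQ
    have : 2 ^ 12 ≤ P ^ 12 := Nat.pow_le_pow_left hP 12
    unfold paramQ; omega
  have hnP : n ≤ P := by
    have : n ≤ n * (r * d * ℓ) := Nat.le_mul_of_pos_right _ (by positivity)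
    rw [hPdef, paramP]; nlinarith
  have hℓP : ℓ ≤ P := by
    have : ℓ ≤ (n * r * d) * ℓ := Nat.le_mul_of_pos_left _ (by positivity)
    rw [hPdef, paramP]; nlinarith
  have hdP : d ≤ P := by
    have : d ≤ d * (n * r * ℓ) := Nat.le_mul_of_pos_right _ (by positivity)
    rw [hPdef, paramP]; nlinarith
  have hrP : r ≤ P := by
    have : r ≤ r * (n * d * ℓ) := Nat.le_mul_of_pos_right _ (by positivity)
    rw [hPdef, paramP]; nlinarith
  have hnℓ : n * ℓ ≤ P := by
    have : n * ℓ ≤ n * ℓ * (r * d) := Nat.le_mul_of_pos_right _ (by positivity)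
    rw [hPdef, paramP]; nlinarith
  have hw : ∀ i ≤ d.size, n * ℓ * ℓ * paramB P ^ i ≤ M := fun i hi => by
    refine le_trans ?_ ((paramG_mono hP hi).trans hG)
    rw [paramG, mul_pow (paramQ P * paramQ P), pow_two]
    refine Nat.mul_le_mul (Nat.mul_le_mul hnℓ hℓP) (Nat.le_mul_of_pos_left _ (by positivity))
  have r1 := paramProg_run (N := N) (k := k) hM (hdP.trans hPM) (hPdef ▸ hPM) (hPdef ▸ hQ) (hPdef ▸ hB)
    (fun i hi => hPdef ▸ (paramG_mono hP hi).trans hG)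
  rw [← hPdef] at r1
  have r2 := pointsProg_run (N := N) (k := k) (r := r) (P := P) hM hQ0 hPB (hnP.trans hPM) (hℓP.trans hPM) hk
    (hdP.trans hPM) ((size_le_self d).trans (hdP.trans hPM)) hG hw
  have hfit : Fits (M * M + 1) [n, ℓ, r, d, N, k] := by
    have hMS : ∀ {x : ℕ}, x.size ≤ M → x.size ≤ M * M + 1 := fun h => h.trans (by nlinarith)
    have hs : ∀ {x : ℕ}, x ≤ P → x.size ≤ M := fun h => (size_le_self _).trans (h.trans hPM)
    intro v hv
    simp only [List.mem_cons, List.not_mem_nil, or_false] at hv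
    rcases hv with rfl | rfl | rfl | rfl | rfl | rfl
    exacts [hMS (hs hnP), hMS (hs hℓP), hMS (hs hrP), hMS (hs hdP), hMS hN, hMS hk]
  obtain ⟨μ, T, e, b, -⟩ := ((r1.andThen r2) hfit).2 (fun i => [n, ℓ, r, d, N, k].getD i 0)
    (fun _ _ => rfl) []
  refine ⟨_, T, e, ?_, b.trans (Nat.mul_le_mul_right _ ?_)⟩
  · rw [encode_hittingSet]; simp [← hPdef]
  · have : (M + 1) ^ 1 ≤ (M + 1) ^ 9 := Nat.pow_le_pow_right (by omega) (by norm_num)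
    rw [pow_one] at this
    omega

end GenABPHitting

/-! ### The quasipolynomial time bound -/

namespace GenABPHitting

/-- The left side is at most `2 ^ (13 e + 40)` with `e` quadratic in `t`; any sufficiently large
constant would do, and 42 is the one that also bounds the size of the hitting set. -/
theorem quasipolynomial_bound (t : ℕ) :
    300 * (2 ^ ((t + 1) * (2 + 40 * (t + 1))) + 1) ^ 9 *
      (2 ^ 20 * (2 ^ ((t + 1) * (2 + 40 * (t + 1))) * 2 ^ ((t + 1) * (2 + 40 * (t + 1))) + 1) ^ 2)
      ≤ 2 ^ ((t + 42) ^ 42) := by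
  set e := (t + 1) * (2 + 40 * (t + 1)) with he
  have h1 : 2 ^ e + 1 ≤ 2 ^ (e + 1) := by
    have : 1 ≤ 2 ^ e := Nat.one_le_two_pow
    rw [pow_succ]; omega
  have h2 : 2 ^ e * 2 ^ e + 1 ≤ 2 ^ (2 * e + 1) := by
    have : 1 ≤ 2 ^ (2 * e) := Nat.one_le_two_pow
    rw [pow_succ, ← pow_add, ← two_mul]; omega
  calc _ ≤ 2 ^ 9 * (2 ^ (e + 1)) ^ 9 * (2 ^ 20 * (2 ^ (2 * e + 1)) ^ 2) := by
        gcongr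
        norm_num
    _ = 2 ^ (13 * e + 40) := by
        rw [← pow_mul, ← pow_mul, ← pow_add, ← pow_add, ← pow_add]; congr 1; ring
    _ ≤ _ := by
        refine Nat.pow_le_pow_right (by norm_num) ?_
        have h3 : (t + 42) ^ 42 = (t + 42) ^ 40 * (t + 42) ^ 2 := by rw [← pow_add]
        have h4 : 42 ^ 2 ≤ (t + 42) ^ 40 :=
          (Nat.pow_le_pow_right (by norm_num) (by norm_num)).trans
            (Nat.pow_le_pow_left (Nat.le_add_left _ _) 40)
        rw [h3]
        refine le_trans ?_ (Nat.mul_le_mul_right _ h4)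
        rw [he]; nlinarith

theorem hittingProg_time {n ℓ r d N k : ℕ} (hn : 0 < n) (hℓ : 0 < ℓ) (hr : 0 < r)
    (hd : 0 < d) (hN : 0 < N) (hk : k ≤ N) :
    ∃ (s : RState) (T : ℕ), RExec hittingProg (RState.init [n, ℓ, r, d, N, k]) s T ∧
      s.out = (hittingSet n ℓ r d k).flatMap SymbPoint.encode ∧
      T ≤ 2 ^ ((Nat.log 2 (n * r * d * ℓ * N.size) + 42) ^ 42) := by
  set t := Nat.log 2 (n * r * d * ℓ * N.size) with ht
  have hNs : 0 < N.size := Nat.size_pos.2 hN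
  have hpos : 0 < n * r * d * ℓ := by positivity
  have hX : n * r * d * ℓ * N.size < 2 ^ (t + 1) := Nat.lt_pow_succ_log_self (by norm_num) _
  have hP : paramP n ℓ r d ≤ 2 ^ (t + 1) := by
    have := Nat.le_mul_of_pos_right (n * r * d * ℓ) hNs
    unfold paramP; omega
  have hNX : N.size ≤ 2 ^ (t + 1) := (Nat.le_mul_of_pos_left _ hpos).trans hX.le
  have hds : d.size ≤ t + 1 := by
    refine Nat.size_le.2 (lt_of_le_of_lt ?_ hX)
    calc d ≤ d * (n * r * ℓ * N.size) := Nat.le_mul_of_pos_right _ (by positivity)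
      _ = _ := by ring
  -- The bound `M` is `P ^ (2 + 40 Λ)` with `P ≤ 2 ^ (t + 1)` and `Λ ≤ t + 1`.
  have hM : 2 ^ (t + 1) ≤ 2 ^ ((t + 1) * (2 + 40 * (t + 1))) :=
    Nat.pow_le_pow_right (by norm_num) (Nat.le_mul_of_pos_right _ (by omega))
  have hG : paramG (paramP n ℓ r d) d.size ≤ 2 ^ ((t + 1) * (2 + 40 * (t + 1))) :=
    calc _ ≤ paramP n ℓ r d ^ (2 + 40 * d.size) :=
          paramG_le (by unfold paramP; omega) _
      _ ≤ (2 ^ (t + 1)) ^ (2 + 40 * d.size) := Nat.pow_le_pow_left hP _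
      _ ≤ (2 ^ (t + 1)) ^ (2 + 40 * (t + 1)) :=
          Nat.pow_le_pow_right (by positivity) (by omega)
      _ = _ := (pow_mul _ _ _).symm
  obtain ⟨s, T, h1, h2, h3⟩ := hittingProg_exec (N := N) (k := k) hn hℓ hr hd (hNX.trans hM)
    ((Nat.size_le_size hk).trans (hNX.trans hM)) hG
  exact ⟨s, T, h1, h2, h3.trans (quasipolynomial_bound t)⟩

end GenABPHitting

namespace GenABPHitting

open scoped Fin.NatCast Fin.CommRing

/-! ### Nonzero elements of the cyclic algebra are invertible -/

section Division

variable {N : ℕ} [NeZero N] {k : (ZMod N)ˣ} {ℓ : ℕ}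

/-- The automorphism `ω ↦ ω ^ k` of the cyclotomic field. -/
noncomputable abbrev cycAut (N : ℕ) [NeZero N] (k : (ZMod N)ˣ) :
    CyclotomicField N ℚ ≃ₐ[ℚ] CyclotomicField N ℚ :=
  (IsCyclotomicExtension.Rat.galEquivZMod N (CyclotomicField N ℚ)).symm k

theorem sigma_algebraMap (p : Polynomial (CyclotomicField N ℚ)) :
    sigma N k (algebraMap _ (KField N) p) = algebraMap _ (KField N)
      (p.map ((cycAut N k).toRingEquiv : CyclotomicField N ℚ →+* CyclotomicField N ℚ)) := by
  rw [sigma, IsFractionRing.ringEquivOfRingEquiv_algebraMap]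
  rfl

theorem sigma_iterate_algebraMap (m : ℕ) (p : Polynomial (CyclotomicField N ℚ)) :
    (sigma N k)^[m] (algebraMap _ (KField N) p) = algebraMap _ (KField N)
      (p.map ((cycAut N k ^ m).toRingEquiv : CyclotomicField N ℚ →+* CyclotomicField N ℚ)) := by
  induction m with
  | zero =>
    have : (((cycAut N k ^ 0).toRingEquiv : CyclotomicField N ℚ →+* CyclotomicField N ℚ)) =
        RingHom.id _ := by ext; simp
    rw [this, Polynomial.map_id]; rfl
  | succ m ih =>
    rw [Function.iterate_succ_apply', ih, sigma_algebraMap, Polynomial.map_map]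
    congr 2
    ext x
    simp [pow_succ']

theorem sigma_iterate_orderOf (hk : orderOf k = ℓ) (b : KField N) : (sigma N k)^[ℓ] b = b := by
  have h1 : cycAut N k ^ ℓ = 1 := by
    rw [cycAut, ← map_pow, ← hk, pow_orderOf_eq_one, map_one]
  have h2 : ∀ p : Polynomial (CyclotomicField N ℚ), (sigma N k)^[ℓ] (algebraMap _ (KField N) p) = algebraMap _ (KField N) p := by
    intro p
    rw [sigma_iterate_algebraMap, h1]
    have : (((1 : CyclotomicField N ℚ ≃ₐ[ℚ] CyclotomicField N ℚ).toRingEquiv :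
      CyclotomicField N ℚ →+* CyclotomicField N ℚ)) = RingHom.id _ := by ext; simp
    rw [this, Polynomial.map_id]
  rw [← RingAut.coe_pow (sigma N k) ℓ] at h2 ⊢
  rw [← RatFunc.num_div_denom b, map_div₀, h2, h2]

/-- The automorphism acts only on coefficients, by a field automorphism, so degrees of numerator and
denominator are kept. -/
theorem intDegree_sigma (b : KField N) : (sigma N k b).intDegree = b.intDegree := by
  by_cases hb : b = 0
  · simp [hb]
  have hn : algebraMap _ (KField N) b.num ≠ 0 := by simpa using RatFunc.num_ne_zero hb
  have hd : algebraMap _ (KField N) b.denom ≠ 0 := by simpa using b.denom_ne_zero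
  rw [← RatFunc.num_div_denom b, map_div₀, RatFunc.intDegree_div (by simpa using hb)
    (by simpa using b.denom_ne_zero), RatFunc.intDegree_div hn hd, sigma_algebraMap,
    sigma_algebraMap]
  simp only [RatFunc.intDegree_polynomial, Polynomial.natDegree_map]

/-- A sum of rational functions with a unique term of maximal degree is nonzero. -/
theorem sum_ne_zero_of_intDegree_lt {L ι : Type*} [Field L] [DecidableEq ι] (s : Finset ι)
    (f : ι → RatFunc L) (i : ι) (hi : i ∈ s) (hfi : f i ≠ 0)
    (h : ∀ j ∈ s, j ≠ i → f j = 0 ∨ (f j).intDegree < (f i).intDegree) :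
    ∑ j ∈ s, f j ≠ 0 := by
  have key : (∑ j ∈ s.erase i, f j) = 0 ∨
      (∑ j ∈ s.erase i, f j).intDegree < (f i).intDegree := by
    refine Finset.sum_induction _ (fun x : RatFunc L => x = 0 ∨ x.intDegree < (f i).intDegree) ?_ (.inl rfl) ?_
    · intro a b ha hb
      by_cases hab : a + b = 0
      · exact .inl hab
      by_cases hb0 : b = 0
      · simpa [hb0] using ha
      by_cases ha0 : a = 0
      · simpa [ha0] using hb
      exact .inr ((RatFunc.intDegree_add_le hb0 hab).trans_lt
        (max_lt (ha.resolve_left ha0) (hb.resolve_left hb0)))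
    · intro j hj
      exact h j (Finset.mem_of_mem_erase hj) (Finset.ne_of_mem_erase hj)
  rw [← Finset.add_sum_erase _ _ hi]
  intro h0
  have h1 : ∑ j ∈ s.erase i, f j = -f i := by linear_combination h0
  rw [h1] at key
  rcases key with h | h
  · exact hfi (by simpa using h)
  · rw [RatFunc.intDegree_neg] at h; exact lt_irrefl _ h

theorem fin_val_add_one [NeZero ℓ] (i : Fin ℓ) :
    ((i + 1 : Fin ℓ) : ℕ) = if (i : ℕ) + 1 = ℓ then 0 else (i : ℕ) + 1 := by
  have hi := i.2
  rw [Fin.val_add, Fin.val_one', Nat.add_mod_mod]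
  split_ifs with h
  · rw [h, Nat.mod_self]
  · rw [Nat.mod_eq_of_lt (by omega)]

theorem Mx_apply [NeZero ℓ] (i j : Fin ℓ) :
    Mx N ℓ i j = if j = i + 1 then (if (i : ℕ) + 1 = ℓ then zvar N else 1) else 0 := by
  have hi := i.2
  have hj := j.2
  simp only [Mx, Matrix.of_apply, Fin.ext_iff, fin_val_add_one]
  split_ifs <;> first | rfl | omega

theorem Mx_mul_apply [NeZero ℓ] (A : Matrix (Fin ℓ) (Fin ℓ) (KField N)) (i j : Fin ℓ) :
    (Mx N ℓ * A) i j = (if (i : ℕ) + 1 = ℓ then zvar N else 1) * A (i + 1) j := by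
  simp [Matrix.mul_apply, Mx_apply]

theorem mul_Mx_apply [NeZero ℓ] (A : Matrix (Fin ℓ) (Fin ℓ) (KField N)) (i j : Fin ℓ) :
    (A * Mx N ℓ) i (j + 1) = A i j * (if (j : ℕ) + 1 = ℓ then zvar N else 1) := by
  simp [Matrix.mul_apply, Mx_apply]

theorem Mx_map_sigma [NeZero ℓ] : (Mx N ℓ).map (sigma N k) = Mx N ℓ := by
  ext i j
  rw [Matrix.map_apply, Mx_apply]
  split_ifs <;> simp [sigma_zvar]

/-- The elements of `D` commute with `M(x)` up to `σ`. -/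
theorem Mx_mul_of_mem [NeZero ℓ] (hk : orderOf k = ℓ) {A : Matrix (Fin ℓ) (Fin ℓ) (KField N)}
    (hA : A ∈ cyclicAlgebra N k ℓ) : Mx N ℓ * A = A.map (sigma N k) * Mx N ℓ := by
  have hdiag : ∀ b, Mx N ℓ * Mdiag N k ℓ b = (Mdiag N k ℓ b).map (sigma N k) * Mx N ℓ := by
    intro b
    ext i j
    simp only [Mdiag, Matrix.diagonal_map (map_zero (sigma N k)), Matrix.mul_diagonal,
      Matrix.diagonal_mul, Mx_apply]
    by_cases hj : j = i + 1
    · subst hj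
      -- In the last row the index wraps around to `0`, which is harmless because `σ ^ ℓ = 1`.
      have h : (sigma N k)^[((i + 1 : Fin ℓ) : ℕ)] b = sigma N k ((sigma N k)^[(i : ℕ)] b) := by
        rw [← Function.iterate_succ_apply' (sigma N k), fin_val_add_one]
        split_ifs with h
        · rw [Nat.succ_eq_add_one, h, sigma_iterate_orderOf hk]; rfl
        · rfl
      simp [h, mul_comm]
    · simp [hj]
  unfold cyclicAlgebra at hA
  induction hA using Algebra.adjoin_induction with
  | mem x hx =>
    rcases hx with rfl | ⟨b, rfl⟩
    · rw [Mx_map_sigma]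
    · exact hdiag b
  | algebraMap c =>
    have hc : sigma N k (c : KField N) = c := c.2
    have : algebraMap (baseField N k) (Matrix (Fin ℓ) (Fin ℓ) (KField N)) c =
        Matrix.scalar (Fin ℓ) (c : KField N) := rfl
    rw [this]
    have h2 : (Matrix.scalar (Fin ℓ) (c : KField N)).map (sigma N k) =
        Matrix.scalar (Fin ℓ) (c : KField N) := by
      rw [Matrix.scalar_apply, Matrix.diagonal_map (map_zero (sigma N k))]
      simp [hc]
    rw [h2]
    ext i j
    simp [Matrix.scalar_apply, mul_comm]
  | add x y _ _ hx hy => rw [mul_add, hx, hy, ← add_mul, Matrix.map_add _ (map_add (sigma N k))]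
  | mul x y _ _ hx hy =>
    rw [← mul_assoc, hx, mul_assoc, hy, ← mul_assoc]
    congr 1
    exact (Matrix.map_mul (f := (sigma N k : KField N →+* KField N))).symm

/-- Compare the entries `(i, j + 1)` in `M(x) A = σ(A) M(x)`. A factor `z` appears exactly when an
index wraps around, and the term `j - i` compensates for it. The quantity `ℓ deg + j - i` is thus
constant along cyclic diagonals; it plays the role of the degree in `x`, where `x ^ ℓ = z`. -/
theorem entry_step [NeZero ℓ] (hk : orderOf k = ℓ) {A : Matrix (Fin ℓ) (Fin ℓ) (KField N)}
    (hA : A ∈ cyclicAlgebra N k ℓ) {i j : Fin ℓ} (hij : A i j ≠ 0) :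
    A (i + 1) (j + 1) ≠ 0 ∧
      ℓ * (A (i + 1) (j + 1)).intDegree + ((j + 1 : Fin ℓ) : ℕ) - ((i + 1 : Fin ℓ) : ℕ) =
        ℓ * (A i j).intDegree + (j : ℕ) - (i : ℕ) := by
  have h := congr_fun (congr_fun (Mx_mul_of_mem hk hA) i) (j + 1)
  rw [Mx_mul_apply, mul_Mx_apply, Matrix.map_apply] at h
  have hz : zvar N ≠ 0 := RatFunc.X_ne_zero
  have hε : ∀ i : Fin ℓ, (if (i : ℕ) + 1 = ℓ then zvar N else 1) ≠ 0 := fun i => by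
    split_ifs
    exacts [hz, one_ne_zero]
  have hdeg : ∀ i : Fin ℓ, (ℓ : ℤ) * (if (i : ℕ) + 1 = ℓ then zvar N else 1).intDegree =
      (i : ℕ) + 1 - ((i + 1 : Fin ℓ) : ℕ) := fun i => by
    rw [fin_val_add_one]
    split_ifs with h
    · rw [zvar, RatFunc.intDegree_X]; push_cast; omega
    · rw [RatFunc.intDegree_one]; push_cast; omega
  have hs : sigma N k (A i j) ≠ 0 := by simpa using hij
  have h0 : A (i + 1) (j + 1) ≠ 0 := by
    intro h0
    rw [h0, mul_zero] at h
    exact mul_ne_zero hs (hε j) h.symm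
  refine ⟨h0, ?_⟩
  have h2 := congr_arg RatFunc.intDegree h
  rw [RatFunc.intDegree_mul (hε i) h0, RatFunc.intDegree_mul hs (hε j), intDegree_sigma] at h2
  have h3 := congr_arg (fun x => (ℓ : ℤ) * x) h2
  simp only [mul_add, hdeg] at h3
  linarith

theorem entry_diagonal [NeZero ℓ] (hk : orderOf k = ℓ) {A : Matrix (Fin ℓ) (Fin ℓ) (KField N)}
    (hA : A ∈ cyclicAlgebra N k ℓ) {i j : Fin ℓ} (hij : A i j ≠ 0) (m : ℕ) :
    A (i + (m : Fin ℓ)) (j + (m : Fin ℓ)) ≠ 0 ∧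
      ℓ * (A (i + (m : Fin ℓ)) (j + (m : Fin ℓ))).intDegree + ((j + (m : Fin ℓ) : Fin ℓ) : ℕ) - ((i + (m : Fin ℓ) : Fin ℓ) : ℕ) =
        ℓ * (A i j).intDegree + (j : ℕ) - (i : ℕ) := by
  induction m with
  | zero => simpa using hij
  | succ m ih =>
    have := entry_step hk hA ih.1
    rw [Nat.cast_succ, ← add_assoc, ← add_assoc]
    exact ⟨this.1, this.2.trans ih.2⟩

/-- The algebra `D` is a division algebra. -/
theorem isUnit_of_mem_cyclicAlgebra (hk : orderOf k = ℓ)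
    {A : Matrix (Fin ℓ) (Fin ℓ) (KField N)} (hA : A ∈ cyclicAlgebra N k ℓ) (hA0 : A ≠ 0) :
    IsUnit A := by
  classical
  have hℓ0 : ℓ ≠ 0 := hk ▸ (orderOf_pos k).ne'
  have : NeZero ℓ := ⟨hℓ0⟩
  rw [← Matrix.mulVec_injective_iff_isUnit]
  refine (injective_iff_map_eq_zero (Matrix.mulVecLin A)).2 fun v hv => ?_
  rw [Matrix.mulVecLin_apply] at hv
  by_contra hv0
  obtain ⟨w₁, hw₁⟩ := Function.ne_iff.1 hv0
  have hA' : ∃ i j, A i j ≠ 0 := by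
    by_contra! h
    exact hA0 (Matrix.ext h)
  obtain ⟨i₁, j₁, hij₁⟩ := hA'
  -- Given a nonzero kernel vector `v`, choose an entry of `A` of maximal `x`-degree and a
  -- coordinate `w` of `v` maximizing `ℓ deg - w`.
  obtain ⟨⟨i₀, j₀⟩, hij₀, hmax⟩ := Finset.exists_max_image
    (Finset.univ.filter fun p : Fin ℓ × Fin ℓ => A p.1 p.2 ≠ 0)
    (fun p => (ℓ : ℤ) * (A p.1 p.2).intDegree + (p.2 : ℕ) - (p.1 : ℕ))
    ⟨(i₁, j₁), by simpa using hij₁⟩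
  obtain ⟨w, hw, hwmax⟩ := Finset.exists_max_image
    (Finset.univ.filter fun w : Fin ℓ => v w ≠ 0)
    (fun w => (ℓ : ℤ) * (v w).intDegree - (w : ℕ)) ⟨w₁, by simpa using hw₁⟩
  simp only [Finset.mem_filter, Finset.mem_univ, true_and, Prod.forall] at hij₀ hmax hw hwmax
  -- Sliding along the cyclic diagonal moves the maximal entry into column `w`; row `u` of `A v`
  -- then has a unique term of maximal degree.
  obtain ⟨hu, hdeg⟩ := entry_diagonal hk hA hij₀ ((w - j₀ : Fin ℓ) : ℕ)
  rw [Fin.cast_val_eq_self, add_sub_cancel] at hu hdeg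
  set u := i₀ + (w - j₀)
  refine sum_ne_zero_of_intDegree_lt Finset.univ (fun j => A u j * v j) w (Finset.mem_univ _)
    (mul_ne_zero hu hw) (fun j _ hj => ?_) (congr_fun hv u)
  by_cases h1 : A u j = 0
  · simp [h1]
  by_cases h2 : v j = 0
  · simp [h2]
  refine .inr ?_
  rw [RatFunc.intDegree_mul h1 h2, RatFunc.intDegree_mul hu hw]
  have h3 := hmax u j h1
  have h4 := hwmax j h2
  -- No ties: the values for `v` have distinct residues modulo `ℓ`.
  have h5 : (ℓ : ℤ) * (v j).intDegree - (j : ℕ) ≠ (ℓ : ℤ) * (v w).intDegree - (w : ℕ) := by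
    intro h
    apply hj
    have h6 : ((j : ℕ) : ℤ) % ℓ = ((w : ℕ) : ℤ) % ℓ := by
      have : ((j : ℕ) : ℤ) = (w : ℕ) + ℓ * ((v j).intDegree - (v w).intDegree) := by linarith
      rw [this, Int.add_mul_emod_self_left]
    rw [← Int.natCast_mod, ← Int.natCast_mod, Nat.mod_eq_of_lt j.2, Nat.mod_eq_of_lt w.2] at h6
    exact Fin.ext (by exact_mod_cast h6)
  have h7 := lt_of_le_of_ne h4 h5
  have h8 : (ℓ : ℤ) * ((A u j).intDegree + (v j).intDegree) <
      ℓ * ((A u w).intDegree + (v w).intDegree) := by linarith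
  exact lt_of_mul_lt_mul_left h8 (by positivity)

end Division

end GenABPHitting

namespace GenABPHitting

/-! ### Isolating sets and separation of words by weights -/

section Isolation

/-- `S` is isolating for the family `A` on `X` with respect to the weights `w`: the weights of its
elements are distinct, and the values of `A` elsewhere on `X` are combinations of values at elements
of `S` of smaller weight. -/
structure IsIsolating (K : Type*) {M ι : Type*} [Field K] [AddCommGroup M] [Module K M]
    (X : Set ι) (A : ι → M) (w : ι → ℕ) (S : Finset ι) : Prop where
  subset : ∀ x ∈ S, x ∈ X
  injOn : ∀ x ∈ S, ∀ y ∈ S, w x = w y → x = y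
  mem_span : ∀ x ∈ X, x ∉ S → A x ∈ Submodule.span K (A '' {y | y ∈ S ∧ w y < w x})

variable {K : Type*} [Field K]

theorem span_image_mono {M ι : Type*} [AddCommGroup M] [Module K M] (A : ι → M) {S T : Set ι}
    {v : M} (hv : v ∈ Submodule.span K (A '' S)) (h : ∀ x ∈ S, x ∈ T) :
    v ∈ Submodule.span K (A '' T) :=
  Submodule.span_mono (Set.image_mono h) hv

namespace IsIsolating

variable {M ι : Type*} [AddCommGroup M] [Module K M] {X : Set ι} {A : ι → M} {w : ι → ℕ}
  {S : Finset ι}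

theorem mem_span_le (h : IsIsolating K X A w S) {x : ι} (hx : x ∈ X) :
    A x ∈ Submodule.span K (A '' {y | y ∈ S ∧ w y ≤ w x}) := by
  by_cases hS : x ∈ S
  · exact Submodule.subset_span ⟨x, ⟨hS, le_rfl⟩, rfl⟩
  · exact span_image_mono A (h.mem_span x hx hS) fun _ hy => ⟨hy.1, hy.2.le⟩

/-- Keep only those elements of `S` whose value is not spanned by values of smaller weight. Spans
below any given weight do not change, and the kept values are linearly independent, so their number
is at most the dimension. -/
theorem exists_card_le [FiniteDimensional K M] (h : IsIsolating K X A w S) :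
    ∃ S', IsIsolating K X A w S' ∧ S'.card ≤ Module.finrank K M := by
  classical
  set S' := S.filter fun y => A y ∉ Submodule.span K (A '' {z | z ∈ S ∧ w z < w y}) with hS'
  have hspan : ∀ n, Submodule.span K (A '' {z | z ∈ S ∧ w z < n}) ≤
      Submodule.span K (A '' {z | z ∈ S' ∧ w z < n}) := by
    intro n
    induction n using Nat.strong_induction_on with
    | _ n ih =>
      rw [Submodule.span_le]
      rintro _ ⟨z, ⟨hz, hzn⟩, rfl⟩
      by_cases hz' : z ∈ S'
      · exact Submodule.subset_span ⟨z, ⟨hz', hzn⟩, rfl⟩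
      · have h1 : A z ∈ Submodule.span K (A '' {y | y ∈ S ∧ w y < w z}) := by
          by_contra h2
          exact hz' (Finset.mem_filter.2 ⟨hz, h2⟩)
        exact span_image_mono A (ih _ hzn h1) fun y hy => ⟨hy.1, hy.2.trans hzn⟩
  -- Elements are inserted by increasing weight. As weights on `S` are distinct, a dependence of the
  -- last one would involve strictly smaller weights only.
  have hind : ∀ s : Finset ι, s ⊆ S' → LinearIndepOn K A (s : Set ι) := by
    intro s
    induction s using Finset.induction_on_max_value w with
    | empty => intro _; simp
    | insert a s ha hmax ih =>
      intro hs
      rw [Finset.insert_subset_iff] at hs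
      rw [Finset.coe_insert, linearIndepOn_insert (by simpa using ha)]
      refine ⟨ih hs.2, fun h1 => (Finset.mem_filter.1 hs.1).2 ?_⟩
      refine span_image_mono A h1 fun y hy => ?_
      have hyS := (Finset.mem_filter.1 (hs.2 hy)).1
      refine ⟨hyS, lt_of_le_of_ne (hmax y hy) fun h2 => ha ?_⟩
      rw [← h.injOn y hyS a (Finset.mem_filter.1 hs.1).1 h2]
      exact hy
  refine ⟨S', ⟨fun x hx => h.subset x (Finset.mem_filter.1 hx).1,
    fun x hx y hy => h.injOn x (Finset.mem_filter.1 hx).1 y (Finset.mem_filter.1 hy).1,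
    fun x hx hxS => hspan _ ?_⟩, ?_⟩
  · by_cases hxS' : x ∈ S
    · by_contra h2
      exact hxS (Finset.mem_filter.2 ⟨hxS', h2⟩)
    · exact h.mem_span x hx hxS'
  · simpa using (hind S' subset_rfl).fintype_card_le_finrank

/-- If one factor lies outside its isolating set, it is a combination of strictly smaller ones; the
other factor needs no larger weights. Multiplying the spans expresses the product by products of
smaller total weight. The new weight `w'` must preserve strict inequalities of `w`, and has to break
ties only on the products of isolated elements. -/
theorem mul {R ι₁ ι₂ ι : Type*} [DecidableEq ι] [Ring R] [Algebra K R] {X₁ : Set ι₁} {X₂ : Set ι₂}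
    {X : Set ι} {A₁ : ι₁ → R} {A₂ : ι₂ → R} {A : ι → R} {w₁ : ι₁ → ℕ} {w₂ : ι₂ → ℕ} {w w' : ι → ℕ}
    {S₁ : Finset ι₁} {S₂ : Finset ι₂} (c : ι₁ → ι₂ → ι)
    (hX : ∀ z, z ∈ X ↔ ∃ x ∈ X₁, ∃ y ∈ X₂, c x y = z)
    (hA : ∀ x ∈ X₁, ∀ y ∈ X₂, A (c x y) = A₁ x * A₂ y)
    (hw : ∀ x ∈ X₁, ∀ y ∈ X₂, w (c x y) = w₁ x + w₂ y)
    (h₁ : IsIsolating K X₁ A₁ w₁ S₁) (h₂ : IsIsolating K X₂ A₂ w₂ S₂)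
    (hmono : ∀ x ∈ X, ∀ y ∈ X, w x < w y → w' x < w' y)
    (hinj : ∀ x ∈ Finset.image₂ c S₁ S₂, ∀ y ∈ Finset.image₂ c S₁ S₂, w' x = w' y → x = y) :
    IsIsolating K X A w' (Finset.image₂ c S₁ S₂) := by
  refine ⟨fun z hz => ?_, hinj, fun z hz hzS => ?_⟩
  · obtain ⟨x, hx, y, hy, rfl⟩ := Finset.mem_image₂.1 hz
    exact (hX _).2 ⟨x, h₁.subset x hx, y, h₂.subset y hy, rfl⟩
  · obtain ⟨x, hx, y, hy, rfl⟩ := (hX z).1 hz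
    have key : ∀ {T₁ : Set ι₁} {T₂ : Set ι₂}, A₁ x ∈ Submodule.span K (A₁ '' T₁) →
        A₂ y ∈ Submodule.span K (A₂ '' T₂) →
        (∀ x' ∈ T₁, ∀ y' ∈ T₂, x' ∈ S₁ ∧ y' ∈ S₂ ∧ w₁ x' + w₂ y' < w₁ x + w₂ y) →
        A (c x y) ∈ Submodule.span K
          (A '' {z' | z' ∈ Finset.image₂ c S₁ S₂ ∧ w' z' < w' (c x y)}) := by
      intro T₁ T₂ hx1 hy1 hT
      rw [hA x hx y hy]
      have := Submodule.mul_mem_mul hx1 hy1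
      rw [Submodule.span_mul_span] at this
      refine Submodule.span_mono ?_ this
      rintro _ ⟨_, ⟨x', hx', rfl⟩, _, ⟨y', hy', rfl⟩, rfl⟩
      obtain ⟨h3, h4, h5⟩ := hT x' hx' y' hy'
      have hx'' := h₁.subset x' h3
      have hy'' := h₂.subset y' h4
      refine ⟨c x' y', ⟨Finset.mem_image₂.2 ⟨x', h3, y', h4, rfl⟩,
        hmono _ ((hX _).2 ⟨x', hx'', y', hy'', rfl⟩) _ hz ?_⟩, hA x' hx'' y' hy''⟩
      rwa [hw x' hx'' y' hy'', hw x hx y hy]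
    by_cases hxS : x ∈ S₁
    · have hyS : y ∉ S₂ := fun hyS => hzS (Finset.mem_image₂.2 ⟨x, hxS, y, hyS, rfl⟩)
      exact key (h₁.mem_span_le hx) (h₂.mem_span y hy hyS)
        fun x' hx' y' hy' => ⟨hx'.1, hy'.1, add_lt_add_of_le_of_lt hx'.2 hy'.2⟩
    · exact key (h₁.mem_span x hx hxS) (h₂.mem_span_le hy)
        fun x' hx' y' hy' => ⟨hx'.1, hy'.1, add_lt_add_of_lt_of_le hx'.2 hy'.2⟩

end IsIsolating

variable {V : Type*}

/-- The product `A a f₀ * A (a + 1) f₁ * ⋯`. -/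
def blockProd {R : Type*} [Ring R] (A : ℕ → V → R) : ℕ → List V → R
  | _, [] => 1
  | a, v :: f => A a v * blockProd A (a + 1) f

/-- The sum `w (τ mod d) f₀ + w ((τ + 1) mod d) f₁ + ⋯`. -/
def blockWeight (d : ℕ) (w : ℕ → V → ℕ) : ℕ → List V → ℕ
  | _, [] => 0
  | τ, v :: f => w (τ % d) v + blockWeight d w (τ + 1) f

theorem blockProd_append {R : Type*} [Ring R] (A : ℕ → V → R) (f g : List V) (a : ℕ) :
    blockProd A a (f ++ g) = blockProd A a f * blockProd A (a + f.length) g := by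
  induction f generalizing a with
  | nil => simp [blockProd]
  | cons v f ih => simp [blockProd, ih, mul_assoc, add_assoc, add_comm 1]

theorem blockWeight_append (d : ℕ) (w : ℕ → V → ℕ) (f g : List V) (τ : ℕ) :
    blockWeight d w τ (f ++ g) = blockWeight d w τ f + blockWeight d w (τ + f.length) g := by
  induction f generalizing τ with
  | nil => simp [blockWeight]
  | cons v f ih => simp [blockWeight, ih, add_assoc, add_comm 1]

theorem blockWeight_refine (d B : ℕ) (w u : ℕ → V → ℕ) (f : List V) (τ : ℕ) :
    blockWeight d (fun τ v => w τ v * B + u τ v) τ f =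
      blockWeight d w τ f * B + blockWeight d u τ f := by
  induction f generalizing τ with
  | nil => simp [blockWeight]
  | cons v f ih => simp only [blockWeight, ih]; ring

theorem blockWeight_le {d C : ℕ} {u : ℕ → V → ℕ} (hu : ∀ τ v, u τ v ≤ C) (f : List V) (τ : ℕ) :
    blockWeight d u τ f ≤ f.length * C := by
  induction f generalizing τ with
  | nil => simp [blockWeight]
  | cons v f ih =>
    simp only [blockWeight, List.length_cons, add_mul, one_mul]
    have := ih (τ + 1)
    have := hu (τ % d) v
    omega

/-- The polynomial `∑ i, f_i X ^ ((τ + i) mod d)`. -/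
noncomputable def blockPoly (p d : ℕ) (enc : V → ℕ) : ℕ → List V → Polynomial (ZMod p)
  | _, [] => 0
  | τ, v :: f => Polynomial.C (enc v : ZMod p) * Polynomial.X ^ (τ % d) +
      blockPoly p d enc (τ + 1) f

variable {p d : ℕ} {enc : V → ℕ}

/-- Modulo `p` the weight of a block is the value at `α` of a polynomial determined by the block, so
different values force different weights. -/
theorem eval_blockPoly (α τ : ℕ) (f : List V) :
    (blockPoly p d enc τ f).eval (α : ZMod p) =
      (blockWeight d (fun τ v => enc v * α ^ τ % p) τ f : ℕ) := by
  induction f generalizing τ with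
  | nil => simp [blockPoly, blockWeight]
  | cons v f ih => simp [blockPoly, blockWeight, ih]

theorem natDegree_blockPoly_lt (hd : 0 < d) (τ : ℕ) (f : List V) :
    (blockPoly p d enc τ f).natDegree < d := by
  induction f generalizing τ with
  | nil => simpa [blockPoly]
  | cons v f ih =>
    refine (Polynomial.natDegree_add_le _ _).trans_lt (max_lt ?_ (ih _))
    exact (Polynomial.natDegree_C_mul_X_pow_le _ _).trans_lt (Nat.mod_lt _ hd)

theorem coeff_blockPoly_eq_zero {e τ : ℕ} {f : List V}
    (h : ∀ i < f.length, (τ + i) % d ≠ e) : (blockPoly p d enc τ f).coeff e = 0 := by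
  induction f generalizing τ with
  | nil => simp [blockPoly]
  | cons v f ih =>
    rw [blockPoly, Polynomial.coeff_add, ih fun i hi => ?_]
    · have := h 0 (by simp)
      simp only [add_zero] at this
      simp [Polynomial.coeff_X_pow, this.symm]
    · have := h (i + 1) (by simpa using hi)
      rwa [show τ + 1 + i = τ + (i + 1) by ring]

/-- A block of length at most `d` occupies distinct positions modulo `d`, so its letters are the
coefficients, recovered because their codes are below `p`. -/
theorem blockPoly_injective (henc : Function.Injective enc) (hp : ∀ v, enc v < p) {τ : ℕ}
    {f g : List V} (hfg : f.length = g.length) (hf : f.length ≤ d)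
    (h : blockPoly p d enc τ f = blockPoly p d enc τ g) : f = g := by
  induction f generalizing τ g with
  | nil => exact (List.length_eq_zero_iff.1 hfg.symm).symm
  | cons v f ih =>
    obtain _ | ⟨v', g⟩ := g
    · simp at hfg
    simp only [List.length_cons, add_left_inj] at hfg hf
    have hzero : ∀ f : List V, f.length + 1 ≤ d →
        (blockPoly p d enc (τ + 1) f).coeff (τ % d) = 0 := fun f hf =>
      coeff_blockPoly_eq_zero fun i hi h => by
        have h2 : (1 + i + τ) ≡ 0 + τ [MOD d] := by
          rw [show 1 + i + τ = τ + 1 + i by ring, zero_add]; exact h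
        have h3 := (Nat.modEq_zero_iff_dvd.1 (Nat.ModEq.add_right_cancel' τ h2))
        have := Nat.le_of_dvd (by omega) h3
        omega
    have hv : v = v' := by
      have h1 := congr_arg (fun q => Polynomial.coeff q (τ % d)) h
      simp only [blockPoly, Polynomial.coeff_add, hzero f hf, hzero g (hfg ▸ hf)] at h1
      simp only [Polynomial.coeff_C_mul, Polynomial.coeff_X_pow, if_true, mul_one,
        add_zero] at h1
      rw [ZMod.natCast_eq_natCast_iff', Nat.mod_eq_of_lt (hp _), Nat.mod_eq_of_lt (hp _)] at h1
      exact henc h1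
    subst hv
    rw [blockPoly, blockPoly, add_right_inj] at h
    rw [ih hfg (by omega) h]

/-- A choice of `α` for which finitely many pairs of blocks get different weights. -/
theorem exists_separating [Fact p.Prime] (henc : Function.Injective enc) (hp : ∀ v, enc v < p)
    (hd : 0 < d) (I : Finset (ℕ × List V × List V))
    (hI : ∀ x ∈ I, x.2.1 ≠ x.2.2 ∧ x.2.1.length = x.2.2.length ∧ x.2.1.length ≤ d)
    (hcard : I.card * d < p) : ∃ α < p, ∀ x ∈ I,
      blockWeight d (fun τ v => enc v * α ^ τ % p) x.1 x.2.1 ≠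
        blockWeight d (fun τ v => enc v * α ^ τ % p) x.1 x.2.2 := by
  classical
  -- The product has degree at most `I.card * d < p`, hence some element of the field is not a root.
  set q : Polynomial (ZMod p) :=
    ∏ x ∈ I, (blockPoly p d enc x.1 x.2.1 - blockPoly p d enc x.1 x.2.2) with hq
  have hq0 : q ≠ 0 := Finset.prod_ne_zero_iff.2 fun x hx h =>
    (hI x hx).1 (blockPoly_injective henc hp (hI x hx).2.1 (hI x hx).2.2 (sub_eq_zero.1 h))
  have hdeg : q.natDegree < p := by
    refine (Polynomial.natDegree_prod_le _ _).trans_lt (lt_of_le_of_lt ?_ hcard)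
    rw [← smul_eq_mul]
    refine Finset.sum_le_card_nsmul _ _ _ fun x _ => ?_
    exact (Polynomial.natDegree_sub_le _ _).trans
      (max_le (natDegree_blockPoly_lt hd _ _).le (natDegree_blockPoly_lt hd _ _).le)
  obtain ⟨α, hα⟩ : ∃ α, q.eval α ≠ 0 := by
    by_contra! h
    refine hq0 (Polynomial.eq_zero_of_natDegree_lt_card_of_eval_eq_zero q (f := id)
      Function.injective_id h (by simpa [ZMod.card] using hdeg))
  refine ⟨α.val, ZMod.val_lt α, fun x hx h => hα ?_⟩
  rw [hq, Polynomial.eval_prod]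
  refine Finset.prod_eq_zero hx ?_
  rw [Polynomial.eval_sub, sub_eq_zero, ← ZMod.natCast_zmod_val α, eval_blockPoly, eval_blockPoly,
    h]

end Isolation

end GenABPHitting

namespace GenABPHitting

/-! ### Doubling the length of isolated blocks -/

section Levels

variable {K : Type*} [Field K] {V : Type*} {R : Type*} [Ring R] [Algebra K R]

/-- All blocks of length at most `b`, at all positions modulo `d`, have small isolating sets. -/
def BlocksIsolated (K : Type*) [Field K] {V R : Type*} [Ring R] [Algebra K R] (A : ℕ → V → R)
    (d : ℕ) (w : ℕ → V → ℕ) (b : ℕ) : Prop :=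
  ∀ s a L, s < d → L ≤ b → a + L ≤ d → ∃ S : Finset (List V),
    IsIsolating K {f | f.length = L} (blockProd A a) (blockWeight d w (s + a)) S ∧
      S.card ≤ Module.finrank K R

theorem blocksIsolated_one [FiniteDimensional K R] [Fintype V] {enc : V → ℕ}
    (henc : Function.Injective enc) (A : ℕ → V → R) (d : ℕ) :
    BlocksIsolated K A d (fun _ v => enc v) 1 := by
  classical
  intro s a L _ hL _
  refine IsIsolating.exists_card_le (S := if L = 0 then {[]} else
    Finset.univ.image fun v => [v]) ?_
  by_cases h : L = 0
  · subst h
    rw [if_pos rfl]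
    refine ⟨by simp, by simp, fun x hx hx' => absurd ?_ hx'⟩
    simpa using hx
  · obtain rfl : L = 1 := by omega
    rw [if_neg h]
    refine ⟨by simp, ?_, fun x hx hx' => absurd ?_ hx'⟩
    · intro x hx y hy hxy
      obtain ⟨v, -, rfl⟩ := Finset.mem_image.1 hx
      obtain ⟨v', -, rfl⟩ := Finset.mem_image.1 hy
      simp only [blockWeight, add_zero] at hxy
      rw [henc hxy]
    · obtain ⟨v, rfl⟩ := List.length_eq_one_iff.1 hx
      simp

/-- Every block of length at most `2 b` splits into two isolated halves. The old weight becomes the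
leading digit to base `paramB P`, and the new digit separates the products of the two isolating
sets, for all shifts, positions and lengths by one common `α`. -/
theorem BlocksIsolated.exists_double [FiniteDimensional K R] {A : ℕ → V → R} {d b P : ℕ} {w : ℕ → V → ℕ} {enc : V → ℕ}
    (henc : Function.Injective enc) (hd : 0 < d) (hdP : d + 1 ≤ P)
    (hfin : Module.finrank K R ≤ P ^ 2) (hencP : ∀ v, enc v < P ^ 2)
    (h : BlocksIsolated K A d w b) :
    ∃ p α, p < paramQ P ∧ α < paramQ P ∧
      BlocksIsolated K A d (fun τ v => w τ v * paramB P + enc v * α ^ τ % (p + 1)) (2 * b) := by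
  classical
  set D := Module.finrank K R with hD
  -- Outside the admissible range the empty set serves as a default, so that the sets can be chosen
  -- as a total function.
  have h' : ∀ s a L, ∃ S : Finset (List V), S.card ≤ D ∧ (s < d → L ≤ b → a + L ≤ d →
      IsIsolating K {f | f.length = L} (blockProd A a) (blockWeight d w (s + a)) S) := by
    intro s a L
    by_cases hc : s < d ∧ L ≤ b ∧ a + L ≤ d
    · obtain ⟨S, hS, hcard⟩ := h s a L hc.1 hc.2.1 hc.2.2
      exact ⟨S, hcard, fun _ _ _ => hS⟩
    · exact ⟨∅, by simp, fun h1 h2 h3 => absurd ⟨h1, h2, h3⟩ hc⟩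
  choose S hScard hS using h'
  set T : ℕ → ℕ → ℕ → Finset (List V) := fun s a L =>
    Finset.image₂ (· ++ ·) (S s a (L / 2)) (S s (a + L / 2) (L - L / 2)) with hT
  have hTcard : ∀ s a L, (T s a L).card ≤ D * D := fun s a L =>
    (Finset.card_image₂_le _ _ _).trans (Nat.mul_le_mul (hScard _ _ _) (hScard _ _ _))
  have hTlen : ∀ s a L, s < d → L ≤ 2 * b → a + L ≤ d → ∀ f ∈ T s a L, f.length = L := by
    intro s a L hs hL haL f hf
    obtain ⟨x, hx, y, hy, rfl⟩ := Finset.mem_image₂.1 hf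
    have h1 := (hS s a (L / 2) hs (by omega) (by omega)).subset x hx
    have h2 := (hS s (a + L / 2) (L - L / 2) hs (by omega) (by omega)).subset y hy
    simp only [Set.mem_ofPred_eq] at h1 h2
    rw [List.length_append, h1, h2]
    omega
  -- All pairs of words that must receive different weights, each with its starting position `s +
  -- a`.
  set I : Finset (ℕ × List V × List V) :=
    (((Finset.range d ×ˢ Finset.range (d + 1) ×ˢ Finset.range (d + 1)).filter fun x =>
      x.2.1 + x.2.2 ≤ d ∧ x.2.2 ≤ 2 * b).biUnion fun x =>
        ((T x.1 x.2.1 x.2.2 ×ˢ T x.1 x.2.1 x.2.2).filter fun y => y.1 ≠ y.2).image fun y =>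
          (x.1 + x.2.1, y.1, y.2)) with hI
  -- Bertrand's postulate supplies the prime; this is why digits range up to `2 * P ^ 12`.
  obtain ⟨p, hp, hpP, hpQ⟩ := Nat.exists_prime_lt_and_le_two_mul (P ^ 12)
    (pow_ne_zero _ (by omega))
  have hPp : ∀ i ≤ 12, P ^ i < p := fun i hi =>
    (Nat.pow_le_pow_right (by omega) hi).trans_lt hpP
  have : Fact p.Prime := ⟨hp⟩
  have hIcard : I.card * d < p := by
    refine lt_of_le_of_lt ?_ hpP
    have h1 : I.card ≤ (d * ((d + 1) * (d + 1))) * ((D * D) * (D * D)) := by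
      refine (Finset.card_biUnion_le_card_mul _ _ ((D * D) * (D * D)) fun x _ => ?_).trans
        (Nat.mul_le_mul_right _ ((Finset.card_filter_le _ _).trans ?_))
      · refine Finset.card_image_le.trans ((Finset.card_filter_le _ _).trans ?_)
        rw [Finset.card_product]
        exact Nat.mul_le_mul (hTcard _ _ _) (hTcard _ _ _)
      · simp
    have hdP' : d ≤ P := by omega
    -- At most `P ^ 3` triples `(s, a, L)`, at most `(P ^ 2) ^ 4` pairs for each, and degree at most
    -- `P`: this gives the exponent 12.
    calc I.card * d ≤ (P * (P * P)) * ((P ^ 2 * P ^ 2) * (P ^ 2 * P ^ 2)) * P := by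
          refine Nat.mul_le_mul (h1.trans ?_) hdP'
          gcongr
      _ = P ^ 12 := by ring
  have hencp : ∀ v, enc v < p := fun v => (hencP v).trans (hPp 2 (by norm_num))
  obtain ⟨α, hα, hsep⟩ := exists_separating henc hencp hd I (by
    intro x hx
    simp only [hI, Finset.mem_biUnion, Finset.mem_filter, Finset.mem_image, Finset.mem_product,
      Finset.mem_range] at hx
    obtain ⟨⟨s, a, L⟩, ⟨⟨hs, _, _⟩, haL, hL⟩, ⟨f, g⟩, ⟨⟨hf, hg⟩, hne⟩, rfl⟩ := hx
    have h1 := hTlen s a L hs hL haL f hf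
    have h2 := hTlen s a L hs hL haL g hg
    have hLd : L ≤ d := by dsimp only at haL; omega
    exact ⟨hne, h1.trans h2.symm, h1.le.trans hLd⟩) hIcard
  have hp1 : p - 1 + 1 = p := by have := hp.pos; omega
  -- The prime is stored as `p - 1`, since `weightStep` adds one to keep its modulus positive.
  refine ⟨p - 1, α, by unfold paramQ; omega, by unfold paramQ; omega, ?_⟩
  rw [hp1]
  set u : ℕ → V → ℕ := fun τ v => enc v * α ^ τ % p
  intro s a L hs hL haL
  -- There is no carry: at most `d < P` residues below `paramQ P` add up to less than the base, so
  -- old strict inequalities survive.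
  have hu : ∀ f : List V, f.length ≤ d → ∀ τ, blockWeight d u τ f < paramB P := by
    intro f hf τ
    have h1 := blockWeight_le (d := d) (C := paramQ P) (u := u) (fun τ v => by
      have := Nat.mod_lt (enc v * α ^ τ) hp.pos
      simp only [u, paramQ]; omega) f τ
    have h2 : 0 < paramQ P := by unfold paramQ; have := hp.pos; omega
    unfold paramB
    calc _ ≤ d * paramQ P := h1.trans (Nat.mul_le_mul_right _ hf)
      _ < P * paramQ P := Nat.mul_lt_mul_of_pos_right (by omega) h2
  refine (IsIsolating.exists_card_le (IsIsolating.mul (X := {f | f.length = L})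
    (A := blockProd A a) (w := blockWeight d w (s + a)) (· ++ ·) ?_ ?_ ?_
    (hS s a (L / 2) hs (by omega) (by omega))
    (hS s (a + L / 2) (L - L / 2) hs (by omega) (by omega)) ?_ ?_))
  · intro f
    constructor
    · intro hf
      simp only [Set.mem_ofPred_eq] at hf
      exact ⟨f.take (L / 2), by simp only [Set.mem_ofPred_eq, List.length_take]; omega,
        f.drop (L / 2), by simp [hf], List.take_append_drop _ _⟩
    · rintro ⟨x, hx, y, hy, rfl⟩
      simp only [Set.mem_ofPred_eq, List.length_append] at *
      omega
  · intro x hx y hy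
    rw [blockProd_append, hx]
  · intro x hx y hy
    rw [blockWeight_append, hx, add_assoc]
  · intro x hx y hy hxy
    rw [blockWeight_refine, blockWeight_refine]
    have h1 := hu x (by rw [hx]; omega) (s + a)
    have h2 : (blockWeight d w (s + a) x + 1) * paramB P ≤
      blockWeight d w (s + a) y * paramB P := Nat.mul_le_mul_right _ hxy
    linarith
  · intro x hx y hy hxy
    rw [blockWeight_refine, blockWeight_refine] at hxy
    have hxl := hTlen s a L hs hL haL x hx
    have hyl := hTlen s a L hs hL haL y hy
    -- Equal refined weights have equal last digits, contrary to the choice of `α`.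
    have h1 := congr_arg (· % paramB P) hxy
    simp only [Nat.mul_add_mod_self_right] at h1
    rw [Nat.mod_eq_of_lt (hu x (by omega) _), Nat.mod_eq_of_lt (hu y (by omega) _)] at h1
    by_contra hne
    refine hsep (s + a, x, y) ?_ h1
    simp only [hI, Finset.mem_biUnion, Finset.mem_filter, Finset.mem_image, Finset.mem_product,
      Finset.mem_range]
    exact ⟨(s, a, L), ⟨⟨hs, by dsimp only; omega, by dsimp only; omega⟩, haL, hL⟩, (x, y),
      ⟨⟨hx, hy⟩, hne⟩, rfl⟩

/-- Some choice number leads to weights with isolating sets for all cyclic shifts. -/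
theorem exists_isolating_choice [FiniteDimensional K R] [Fintype V] {A : ℕ → V → R}
    {d P : ℕ} {enc : V → ℕ}
    (henc : Function.Injective enc) (hd : 0 < d) (hdP : d + 1 ≤ P)
    (hfin : Module.finrank K R ≤ P ^ 2) (hencP : ∀ v, enc v < P ^ 2) (Λ : ℕ) :
    ∃ (w : ℕ → V → ℕ) (φ : ℕ → ℕ),
      (∀ t, φ t < (paramQ P * paramQ P) ^ Λ * (t + 1)) ∧
      (∀ t τ v, (weightStep (paramQ P) (paramB P) (enc v) τ)^[Λ] (φ t, enc v) = (t, w τ v)) ∧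
      BlocksIsolated K A d w (2 ^ Λ) := by
  induction Λ with
  | zero =>
    exact ⟨fun _ v => enc v, id, fun t => by simp, fun t τ v => rfl,
      blocksIsolated_one henc A d⟩
  | succ Λ ih =>
    obtain ⟨w, φ, h1, h2, h3⟩ := ih
    obtain ⟨p, α, hp, hα, h4⟩ := h3.exists_double henc hd hdP hfin hencP
    set Q := paramQ P
    -- After the earlier rounds have consumed their digits, the remaining number is `p + Q (α + Q
    -- t)`; one more `weightStep` reads both digits and leaves `t`.
    refine ⟨_, fun t => φ (p + Q * (α + Q * t)), fun t => ?_, fun t τ v => ?_,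
      by rwa [pow_succ, mul_comm]⟩
    · refine (h1 _).trans_le ?_
      rw [pow_succ, mul_assoc]
      refine Nat.mul_le_mul_left _ ?_
      have h5 : α + Q * t + 1 ≤ Q * (t + 1) := by rw [mul_add]; omega
      have h6 : Q * (α + Q * t + 1) ≤ Q * (Q * (t + 1)) := Nat.mul_le_mul_left _ h5
      linarith
    · have hQ : 0 < Q := by omega
      rw [Function.iterate_succ_apply', h2]
      simp only [weightStep]
      rw [Nat.add_mul_div_left _ _ hQ, Nat.div_eq_of_lt hp, zero_add, Nat.add_mul_div_left _ _ hQ,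
        Nat.div_eq_of_lt hα, zero_add, Nat.add_mul_mod_self_left, Nat.mod_eq_of_lt hα,
        Nat.add_mul_mod_self_left, Nat.mod_eq_of_lt hp]

end Levels

end GenABPHitting

namespace GenABPHitting

/-! ### From isolating weights to nonzero values -/

section Evaluation

variable {K : Type*} [Field K] {V : Type*} {R : Type*} [Ring R] [Algebra K R]

theorem blockProd_ofFn (A : ℕ → V → R) {m : ℕ} (f : Fin m → V) (a : ℕ) :
    blockProd A a (List.ofFn f) = (List.ofFn fun t : Fin m => A (a + t) (f t)).prod := by
  induction m generalizing a with
  | zero => simp [blockProd]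
  | succ m ih => simp [List.ofFn_succ, blockProd, ih, add_assoc, add_comm 1]

theorem blockWeight_ofFn (d : ℕ) (w : ℕ → V → ℕ) {m : ℕ} (f : Fin m → V) (τ : ℕ) :
    blockWeight d w τ (List.ofFn f) = ∑ t : Fin m, w ((τ + t) % d) (f t) := by
  induction m generalizing τ with
  | zero => simp [blockWeight]
  | succ m ih =>
    simp [List.ofFn_succ, blockWeight, ih, Fin.sum_univ_succ, add_assoc, add_comm 1]

/-- Noncommutative expansion of a product of linear combinations. -/
theorem prod_ofFn_sum_smul [Fintype V] {m : ℕ} (c : Fin m → V → K) (A : Fin m → V → R) :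
    (List.ofFn fun t => ∑ v, c t v • A t v).prod =
      ∑ f : Fin m → V, (∏ t, c t (f t)) • (List.ofFn fun t => A t (f t)).prod := by
  classical
  have h := (MultilinearMap.mkPiAlgebraFin K m R).map_sum (fun t v => c t v • A t v)
  simp only [MultilinearMap.mkPiAlgebraFin_apply] at h
  rw [h]
  refine Finset.sum_congr rfl fun f _ => ?_
  have h2 := (MultilinearMap.mkPiAlgebraFin K m R).map_smul_univ (fun t => c t (f t))
    (fun t => A t (f t))
  simpa only [MultilinearMap.mkPiAlgebraFin_apply] using h2

/-- If some value of `A` is not in the kernel of `L`, the polynomial `∑ x, L (A x) X ^ (w x)` is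
nonzero. -/
theorem IsIsolating.sum_monomial_ne_zero {M ι : Type*} [AddCommGroup M] [Module K M] {X : Finset ι}
    {A : ι → M} {w : ι → ℕ} {S : Finset ι} (h : IsIsolating K (X : Set ι) A w S) (L : M →ₗ[K] K)
    {x : ι} (hx : x ∈ X) (hLx : L (A x) ≠ 0) :
    ∑ x ∈ X, Polynomial.monomial (w x) (L (A x)) ≠ 0 := by
  classical
  have hker : ∀ T : Set ι, (∀ y ∈ T, L (A y) = 0) → ∀ v ∈ Submodule.span K (A '' T), L v = 0 := by
    intro T hT v hv
    have : Submodule.span K (A '' T) ≤ LinearMap.ker L := by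
      rw [Submodule.span_le]
      rintro _ ⟨y, hy, rfl⟩
      exact hT y hy
    exact this hv
  have hex : (S.filter fun y => L (A y) ≠ 0).Nonempty := by
    by_contra hne
    rw [Finset.not_nonempty_iff_eq_empty, Finset.filter_eq_empty_iff] at hne
    exact hLx (hker _ (fun y hy => not_not.1 (hne hy.1)) _ (h.mem_span_le hx))
  -- The coefficient at the least weight of an isolated `y` with `L (A y) ≠ 0` receives no other
  -- contribution: other isolated elements have other weights, and `L` kills non-isolated ones of
  -- this weight, which are combinations of smaller isolated values.
  obtain ⟨y, hy, hmin⟩ := Finset.exists_min_image _ w hex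
  rw [Finset.mem_filter] at hy
  intro h0
  have h1 := congr_arg (fun q => Polynomial.coeff q (w y)) h0
  simp only [Polynomial.finsetSum_coeff, Polynomial.coeff_monomial, Polynomial.coeff_zero] at h1
  rw [Finset.sum_eq_single_of_mem y (h.subset y hy.1), if_pos rfl] at h1
  · exact hy.2 h1
  · intro z hz hzy
    split_ifs with hw
    · by_cases hzS : z ∈ S
      · exact absurd (h.injOn z hzS y hy.1 hw) hzy
      · refine hker _ (fun u hu => ?_) _ (h.mem_span z hz hzS)
        by_contra hLu
        have := hmin u (Finset.mem_filter.2 ⟨hu.1, hLu⟩)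
        have := hu.2
        omega
    · rfl

/-- A common choice number for which all cyclic shifts of a product are nonzero. -/
theorem exists_choice_ne_zero [CharZero K] [FiniteDimensional K R] [Fintype V] {A : ℕ → V → R}
    {d P m : ℕ} {enc : V → ℕ} (henc : Function.Injective enc) (hd : 0 < d) (hdP : d + 1 ≤ P)
    (hfin : Module.finrank K R ≤ P ^ 2) (hencm : ∀ v, enc v < m) (hm : d * d * m ≤ P ^ 2)
    {Λ : ℕ} (hΛ : d ≤ 2 ^ Λ) (L : R →ₗ[K] K) (f₀ : Fin d → V)
    (hf₀ : L (List.ofFn fun t : Fin d => A t (f₀ t)).prod ≠ 0) :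
    ∃ g < paramG P Λ, ∀ s < d, L (List.ofFn fun t : Fin d => ∑ v,
      (choiceCoeff (paramQ P) (paramB P) Λ g (enc v) ((s + t) % d) : K) • A t v).prod ≠ 0 := by
  classical
  have hP0 : 0 < P := by omega
  have hQ0 : 0 < paramQ P := by unfold paramQ; positivity
  have hQB : paramQ P ≤ paramB P := Nat.le_mul_of_pos_left _ hP0
  have hmP : m ≤ P ^ 2 := (Nat.le_mul_of_pos_left _ (by positivity)).trans hm
  have hm0 : 0 < m := (Nat.zero_le _).trans_lt (hencm (f₀ ⟨0, hd⟩))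
  obtain ⟨w, φ, h1, h2, h3⟩ := exists_isolating_choice (K := K) (A := A) henc hd hdP hfin
    (fun v => (hencm v).trans_le hmP) Λ
  have hw : ∀ τ v, w τ v ≤ m * paramB P ^ Λ - 1 := fun τ v => by
    have h4 := weightStep_iterate_snd_lt (g := φ 0) (τ := τ) (hencm v) hQ0 hQB Λ
    rw [h2] at h4
    exact Nat.le_sub_one_of_lt h4
  -- The value of shift `s` as a polynomial in the still undetermined base `t` of the powers.
  set q : ℕ → Polynomial K := fun s => ∑ f : Fin d → V,
    Polynomial.monomial (blockWeight d w s (List.ofFn f)) (L (blockProd A 0 (List.ofFn f))) with hq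
  have hq0 : ∀ s < d, q s ≠ 0 := by
    intro s hs
    obtain ⟨S, hS, -⟩ := h3 s 0 d hs hΛ (by omega)
    have hX : {f : List V | f.length = d} =
        ((Finset.univ.image fun f : Fin d → V => List.ofFn f : Finset (List V)) :
          Set (List V)) := by
      ext f
      simp only [Set.mem_ofPred_eq, Finset.coe_image, Finset.coe_univ, Set.image_univ,
        Set.mem_range]
      constructor
      · rintro rfl; exact ⟨f.get, List.ofFn_get f⟩
      · rintro ⟨f, rfl⟩; simp
    rw [hX] at hS
    have h4 := hS.sum_monomial_ne_zero L
      (Finset.mem_image_of_mem (fun f : Fin d → V => List.ofFn f) (Finset.mem_univ f₀))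
      (by rw [blockProd_ofFn]; simpa using hf₀)
    rwa [Finset.sum_image (fun _ _ _ _ h => List.ofFn_injective h)] at h4
  have hdeg : ∀ s, (q s).natDegree ≤ d * (m * paramB P ^ Λ - 1) := by
    intro s
    refine Polynomial.natDegree_sum_le_of_forall_le _ _ fun f _ => ?_
    refine (Polynomial.natDegree_monomial_le _).trans ?_
    simpa using blockWeight_le hw (List.ofFn f) s
  set T := P ^ 2 * paramB P ^ Λ with hT
  have hmB : 0 < m * paramB P ^ Λ := Nat.mul_pos hm0 (Nat.pow_pos (hQ0.trans_le hQB))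
  have hprod : (∏ s ∈ Finset.range d, q s).natDegree < T := by
    calc (∏ s ∈ Finset.range d, q s).natDegree ≤ ∑ s ∈ Finset.range d, (q s).natDegree :=
          Polynomial.natDegree_prod_le _ _
      _ ≤ d * (d * (m * paramB P ^ Λ - 1)) := by
          have := Finset.sum_le_card_nsmul (Finset.range d) (fun s => (q s).natDegree) _
            fun s _ => hdeg s
          simpa using this
      _ < d * (d * (m * paramB P ^ Λ)) := by
          refine Nat.mul_lt_mul_of_pos_left (Nat.mul_lt_mul_of_pos_left (by omega) hd) hd
      _ = d * d * m * paramB P ^ Λ := by ring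
      _ ≤ T := Nat.mul_le_mul_right _ hm
  -- In characteristic zero the numbers below `T` are distinct, and they outnumber the roots of the
  -- product over all shifts.
  obtain ⟨t, ht, htq⟩ : ∃ t < T, (∏ s ∈ Finset.range d, q s).eval (t : K) ≠ 0 := by
    by_contra! h
    refine Finset.prod_ne_zero_iff.2 (fun s hs => hq0 s (Finset.mem_range.1 hs))
      (Polynomial.eq_zero_of_natDegree_lt_card_of_eval_eq_zero _
        (f := fun i : Fin T => ((i : ℕ) : K)) (fun i j hij => Fin.ext (Nat.cast_injective hij))
        (fun i => h i i.2) (by simpa using hprod))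
  rw [Polynomial.eval_prod, Finset.prod_ne_zero_iff] at htq
  refine ⟨φ t, ?_, fun s hs => ?_⟩
  · refine (h1 t).trans_le ?_
    calc (paramQ P * paramQ P) ^ Λ * (t + 1) ≤ (paramQ P * paramQ P) ^ Λ * T :=
          Nat.mul_le_mul_left _ ht
      _ = paramG P Λ := by rw [hT, paramG, mul_pow (paramQ P * paramQ P)]; ring
  · have h4 := htq s (Finset.mem_range.2 hs)
    rw [prod_ofFn_sum_smul, map_sum]
    rw [hq, Polynomial.eval_finsetSum] at h4
    convert h4 using 1
    refine Finset.sum_congr rfl fun f _ => ?_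
    rw [Polynomial.eval_monomial, map_smul, smul_eq_mul, mul_comm, blockProd_ofFn,
      blockWeight_ofFn, ← Finset.prod_pow_eq_pow_sum]
    simp only [choiceCoeff, h2, zero_add, Nat.cast_pow]

end Evaluation

end GenABPHitting

/-! ### Block-cyclic matrices and ordered products -/

namespace GenABPHitting

open scoped Fin.NatCast Fin.CommRing

theorem inclusion_one {K : Type} [Field K] {m d : ℕ} :
    inclusion d (1 : Matrix (Fin m) (Fin m) K) = 1 := by
  simp [inclusion]

section Cyclic

variable {K : Type} [Field K] {m d : ℕ} [NeZero d]

/-- The block matrix with the block `q s` in the block position `(s, s + e)` (cyclically). -/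
def cyclicBlocks (e : Fin d) (q : Fin d → Matrix (Fin m) (Fin m) K) :
    Matrix (Fin m × Fin d) (Fin m × Fin d) K :=
  Matrix.of fun u v => if v.2 = u.2 + e then q u.2 u.1 v.1 else 0

theorem cyclicBlocks_mul (e e' : Fin d) (q q' : Fin d → Matrix (Fin m) (Fin m) K) :
    cyclicBlocks e q * cyclicBlocks e' q' =
      cyclicBlocks (e + e') fun s => q s * q' (s + e) := by
  ext u v
  simp only [cyclicBlocks, Matrix.mul_apply, Matrix.of_apply, Fintype.sum_prod_type_right]
  rw [Finset.sum_eq_single (u.2 + e)]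
  · by_cases h : v.2 = u.2 + e + e'
    · simp [h, add_assoc]
    · simp [h, ← add_assoc]
  · intro b _ hb
    simp [hb]
  · simp

theorem inclusion_eq_cyclicBlocks (a : Matrix (Fin m) (Fin m) K) :
    inclusion d a = cyclicBlocks 0 fun _ => a := by
  ext u v
  simp [inclusion, cyclicBlocks, Matrix.kroneckerMap_apply, Matrix.one_apply, eq_comm]

theorem cyclicBlocks_zero (q : Fin d → Matrix (Fin m) (Fin m) K) :
    cyclicBlocks 0 q = Matrix.blockDiagonal q := by
  ext ⟨i, s⟩ ⟨j, s'⟩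
  simp [cyclicBlocks, Matrix.blockDiagonal_apply, eq_comm]

theorem inclusion_mul (a b : Matrix (Fin m) (Fin m) K) :
    inclusion d (a * b) = inclusion d a * inclusion d b := by
  simp [inclusion_eq_cyclicBlocks, cyclicBlocks_mul]

/-- Offsets add under multiplication, and the factor at position `t` is met in block row `s + t`. -/
theorem prod_cyclicBlocks {e : ℕ} (Q : Fin e → Fin d → Matrix (Fin m) (Fin m) K) :
    (List.ofFn fun t => cyclicBlocks 1 (Q t)).prod =
      cyclicBlocks (e : Fin d) fun s =>
        (List.ofFn fun t : Fin e => Q t (s + ((t : ℕ) : Fin d))).prod := by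
  induction e with
  | zero =>
    simp only [List.ofFn_zero, List.prod_nil, Nat.cast_zero]
    rw [← inclusion_one, inclusion_eq_cyclicBlocks]
  | succ e ih =>
    rw [List.ofFn_succ, List.prod_cons, ih, cyclicBlocks_mul]
    simp [List.ofFn_succ, add_assoc, add_comm (1 : Fin d)]

end Cyclic

/-- Passes between the two groupings of a path: the coefficients of a generalized word are the
products `b a'` of adjacent constants, whereas the edge labels group `a p b`. -/
theorem prod_ofFn_rebracket {M : Type*} [Monoid M] {m : ℕ} (l : Fin (m + 1) → M) (p r : Fin m → M) :
    l 0 * (List.ofFn fun t => p t * (r t * l t.succ)).prod =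
      (List.ofFn fun t => l t.castSucc * p t * r t).prod * l (Fin.last m) := by
  induction m with
  | zero => simp
  | succ m ih =>
    have := ih (fun t => l t.succ) (fun t => p t.succ) (fun t => r t.succ)
    simp only [List.ofFn_succ, List.prod_cons]
    simp only [Fin.succ_castSucc] at this
    rw [← Fin.succ_last, mul_assoc (l (Fin.castSucc 0) * p 0 * r 0), ← this]
    simp [mul_assoc]

/-- An entry of a product of transition matrices is the sum over paths; this turns the ABP into an
iterated matrix product. -/
theorem matrix_prod_ofFn_apply {R ι : Type*} [Semiring R] [Fintype ι] [DecidableEq ι] {m : ℕ}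
    (A : Fin m → Matrix ι ι R) (u u' : ι) :
    (List.ofFn A).prod u u' = ∑ v ∈ Finset.univ.filter
      (fun v : Fin (m + 1) → ι => v 0 = u ∧ v (Fin.last m) = u'),
        (List.ofFn fun t => A t (v t.castSucc) (v t.succ)).prod := by
  induction m generalizing u with
  | zero =>
    simp only [List.ofFn_zero, List.prod_nil, Matrix.one_apply]
    rw [Finset.sum_const, ← Fintype.card_subtype]
    by_cases h : u = u'
    · subst h
      have : Fintype.card {v : Fin 1 → ι // v 0 = u ∧ v (Fin.last 0) = u} = 1 := by
        rw [Fintype.card_eq_one_iff]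
        refine ⟨⟨fun _ => u, rfl, rfl⟩, fun y => Subtype.ext (funext fun i => ?_)⟩
        rw [Fin.eq_zero i]; exact y.2.1
      simp only [Nat.reduceAdd] at this ⊢
      rw [this]; simp
    · have : IsEmpty {v : Fin 1 → ι // v 0 = u ∧ v (Fin.last 0) = u'} :=
        ⟨fun v => h (v.2.1.symm.trans v.2.2)⟩
      rw [Fintype.card_eq_zero, if_neg h, zero_smul]
  | succ m ih =>
    rw [List.ofFn_succ, List.prod_cons, Matrix.mul_apply]
    simp only [ih, Finset.mul_sum, Finset.sum_filter]
    rw [← (Fin.consEquiv (fun _ : Fin (m + 2) => ι)).sum_comp, Fintype.sum_prod_type,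
      Finset.sum_comm, Finset.sum_comm (s := Finset.univ (α := ι))]
    refine Finset.sum_congr rfl fun v _ => ?_
    rw [Finset.sum_eq_single (v 0), Finset.sum_eq_single u]
    · simp [Fin.consEquiv, List.ofFn_succ, ← Fin.succ_last]
    · intro b _ hb; simp [Fin.consEquiv, hb]
    · simp
    · intro b _ hb; simp [hb.symm]
    · simp

theorem prod_single_mul_apply {R ι : Type*} [CommRing R] [Fintype ι] [DecidableEq ι] {m : ℕ}
    (c : Fin (m + 1) → Matrix ι ι R) (row col : Fin (m + 1) → ι) :
    (c 0 * (List.ofFn fun t : Fin m =>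
      Matrix.single (col t.castSucc) (row t.succ) (1 : R) * c t.succ).prod)
        (row 0) (col (Fin.last m)) = ∏ t, c t (row t) (col t) := by
  induction m with
  | zero => simp
  | succ m ih =>
    have := ih (fun t => c t.succ) (fun t => row t.succ) (fun t => col t.succ)
    rw [Fin.prod_univ_succ, ← this, List.ofFn_succ, List.prod_cons, Matrix.mul_apply,
      Finset.sum_eq_single (col 0)]
    · congr 1
      rw [Fin.castSucc_zero, mul_assoc, Matrix.single_mul_apply_same]
      simp
    · intro b _ hb
      rw [Fin.castSucc_zero, mul_assoc, Matrix.single_mul_apply_of_ne _ _ _ _ _ hb, mul_zero]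
    · simp

end GenABPHitting

namespace GenABPHitting

open scoped Fin.NatCast Fin.CommRing

/-! ### A spanning set of the matrix algebra inside `D` -/

section Basis

variable {N : ℕ} [NeZero N] {k : (ZMod N)ˣ} {ℓ : ℕ}

/-- The product `M(ω ^ a) M(x) ^ b`. -/
noncomputable def basisElem (N : ℕ) [NeZero N] (k : (ZMod N)ˣ) (ℓ : ℕ) (a b : ℕ) :
    Matrix (Fin ℓ) (Fin ℓ) (KField N) :=
  Mdiag N k ℓ (omega N ^ a) * Mx N ℓ ^ b

theorem basisElem_mem (a b : ℕ) : basisElem N k ℓ a b ∈ cyclicAlgebra N k ℓ :=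
  mul_mem (Algebra.subset_adjoin (.inr ⟨_, rfl⟩))
    (pow_mem (Algebra.subset_adjoin (.inl rfl)) _)

theorem sigma_iterate_omega (i : ℕ) :
    (sigma N k)^[i] (omega N) = omega N ^ (k : ZMod N).val ^ i := by
  induction i with
  | zero => simp
  | succ i ih => rw [Function.iterate_succ_apply', ih, map_pow, sigma_omega, ← pow_mul, pow_succ,
      mul_comm]

theorem sigma_iterate_omega_pow (i a : ℕ) :
    (sigma N k)^[i] (omega N ^ a) = omega N ^ (a * (k : ZMod N).val ^ i) := by
  rw [iterate_map_pow, sigma_iterate_omega, ← pow_mul, mul_comm]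

/-- The exponent `(i + b) / ℓ` counts how often `b` steps from row `i` wrap around. -/
theorem Mx_pow_apply [NeZero ℓ] (b : ℕ) (i j : Fin ℓ) :
    (Mx N ℓ ^ b) i j = if j = i + (b : Fin ℓ) then zvar N ^ (((i : ℕ) + b) / ℓ) else 0 := by
  induction b generalizing j with
  | zero =>
    simp [Matrix.one_apply, Nat.div_eq_of_lt i.2, eq_comm]
  | succ b ih =>
    obtain ⟨j, rfl⟩ : ∃ j', j = j' + 1 := ⟨j - 1, by simp⟩
    rw [pow_succ, mul_Mx_apply, ih, Nat.cast_succ, ← add_assoc]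
    simp only [add_left_inj]
    by_cases h : j = i + (b : Fin ℓ)
    · rw [if_pos h, if_pos h, ← add_assoc (i : ℕ), Nat.succ_div]
      have hj : (j : ℕ) = ((i : ℕ) + b) % ℓ := by
        rw [h, Fin.val_add, Fin.val_natCast, Nat.add_mod_mod]
      have hiff : (j : ℕ) + 1 = ℓ ↔ ℓ ∣ (i : ℕ) + b + 1 := by
        have hlt := j.2
        rw [Nat.dvd_iff_mod_eq_zero, Nat.add_mod, ← hj]
        constructor
        · intro h1
          rw [Nat.add_mod_mod, h1, Nat.mod_self]
        · intro h1
          rw [Nat.add_mod_mod] at h1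
          have := Nat.le_of_dvd (by omega) (Nat.dvd_of_mod_eq_zero h1)
          omega
      simp only [hiff]
      split_ifs
      · rw [pow_succ]
      · simp
    · rw [if_neg h, if_neg h, zero_mul]

theorem basisElem_apply [NeZero ℓ] (a b : ℕ) (i j : Fin ℓ) :
    basisElem N k ℓ a b i j = if j = i + (b : Fin ℓ) then
      omega N ^ (a * (k : ZMod N).val ^ (i : ℕ)) * zvar N ^ (((i : ℕ) + b) / ℓ) else 0 := by
  rw [basisElem, Mdiag, Matrix.diagonal_mul, Mx_pow_apply, sigma_iterate_omega_pow]
  split_ifs <;> simp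

theorem omega_isPrimitiveRoot : IsPrimitiveRoot (omega N) N :=
  (IsCyclotomicExtension.zeta_spec N ℚ (CyclotomicField N ℚ)).map_of_injective
    (f := (RatFunc.C : CyclotomicField N ℚ →+* KField N)) (RingHom.injective _)

/-- The powers `k ^ i` with `i < ℓ` are distinct modulo `N` because `ℓ` is the order of `k`. These
conjugates of `ω` are the Vandermonde nodes below. -/
theorem sigma_iterate_omega_injective (hk : orderOf k = ℓ) :
    Function.Injective fun i : Fin ℓ => omega N ^ (k : ZMod N).val ^ (i : ℕ) := by
  intro i j hij
  dsimp only at hij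
  have hN : 0 < N := Nat.pos_of_ne_zero (NeZero.ne N)
  rw [← pow_mod_orderOf, ← pow_mod_orderOf (omega N) ((k : ZMod N).val ^ (j : ℕ)),
    ← omega_isPrimitiveRoot.eq_orderOf] at hij
  have hij := omega_isPrimitiveRoot.pow_inj (Nat.mod_lt _ hN) (Nat.mod_lt _ hN) hij
  rw [← ZMod.natCast_eq_natCast_iff', Nat.cast_pow, Nat.cast_pow, ZMod.natCast_zmod_val,
    ← Units.val_pow_eq_pow_val, ← Units.val_pow_eq_pow_val, Units.val_inj,
    pow_eq_pow_iff_modEq, hk] at hij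
  exact Fin.ext (by rw [← Nat.mod_eq_of_lt i.2, ← Nat.mod_eq_of_lt j.2]; exact hij)

/-- The products `M(ω ^ a) M(x) ^ b` span the matrix algebra. -/
theorem exists_sum_basisElem (hk : orderOf k = ℓ) (u w : Fin ℓ) :
    ∃ c : Fin ℓ × Fin ℓ → KField N,
      Matrix.single u w 1 = ∑ p, c p • basisElem N k ℓ p.1 p.2 := by
  have hℓ0 : ℓ ≠ 0 := hk ▸ (orderOf_pos k).ne'
  have : NeZero ℓ := ⟨hℓ0⟩
  set x : Fin ℓ → KField N := fun i => omega N ^ (k : ZMod N).val ^ (i : ℕ) with hx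
  have hdet : IsUnit (Matrix.vandermonde x) := by
    rw [Matrix.isUnit_iff_isUnit_det, isUnit_iff_ne_zero]
    exact Matrix.det_vandermonde_ne_zero_iff.2 (sigma_iterate_omega_injective hk)
  -- The exponent `b = w - u` selects the cyclic diagonal through `(u, w)`; inverting the
  -- Vandermonde matrix singles out row `u` on it, and the power of `z` found there is divided out.
  obtain ⟨c, hc⟩ := (Matrix.mulVec_surjective_iff_isUnit.2 hdet) (Pi.single u 1)
  set e := ((u : ℕ) + ((w - u : Fin ℓ) : ℕ)) / ℓ
  have hz : zvar N ^ e ≠ 0 := pow_ne_zero _ RatFunc.X_ne_zero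
  refine ⟨fun p => if p.2 = w - u then c p.1 * (zvar N ^ e)⁻¹ else 0, ?_⟩
  ext i j
  rw [Matrix.sum_apply, Fintype.sum_prod_type]
  simp only [Matrix.smul_apply, smul_eq_mul, ite_mul, zero_mul, Finset.sum_ite_eq',
    Finset.mem_univ, if_true, basisElem_apply, Fin.cast_val_eq_self]
  by_cases hj : j = i + (w - u)
  · have hci := congr_fun hc i
    simp only [Matrix.mulVec, dotProduct, Matrix.vandermonde_apply, hx, ← pow_mul] at hci
    simp only [if_pos hj]
    by_cases hi : i = u
    · subst hi
      have hjw : w = j := by rw [hj, add_sub_cancel]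
      subst hjw
      rw [Matrix.single_apply_same]
      rw [Pi.single_eq_same] at hci
      rw [← hci]
      refine Finset.sum_congr rfl fun a _ => ?_
      field_simp
      rw [mul_comm (a : ℕ)]
      ring
    · rw [Pi.single_eq_of_ne hi] at hci
      rw [Matrix.single_apply_of_row_ne (Ne.symm hi)]
      have : ∀ a : Fin ℓ, c a * (zvar N ^ e)⁻¹ * (omega N ^ ((a : ℕ) *
          (k : ZMod N).val ^ (i : ℕ)) * zvar N ^ (((i : ℕ) + ((w - u : Fin ℓ) : ℕ)) / ℓ)) =
          (omega N ^ ((k : ZMod N).val ^ (i : ℕ) * (a : ℕ)) * c a) * ((zvar N ^ e)⁻¹ *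
            zvar N ^ (((i : ℕ) + ((w - u : Fin ℓ) : ℕ)) / ℓ)) := fun a => by
        rw [mul_comm (a : ℕ)]; ring
      simp only [this]
      rw [← Finset.sum_mul, hci, zero_mul]
  · simp only [if_neg hj, mul_zero, Finset.sum_const_zero]
    rw [Matrix.single_apply, if_neg]
    rintro ⟨rfl, rfl⟩
    exact hj (by rw [add_sub_cancel])

end Basis

end GenABPHitting

namespace GenABPHitting

open scoped Fin.NatCast Fin.CommRing

/-! ### Generalized ABPs as products of label matrices -/

section Labels

variable {K F : Type} [Field K] [Field F] [Algebra F K] {m : ℕ}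
  {D : Subalgebra F (Matrix (Fin m) (Fin m) K)} {n d r : ℕ}

/-- The matrix of the terms `a q b` of the edge labels between two layers. -/
def GenABP.label (B : GenABP D n d r) (t : Fin d) (x : Fin n) :
    Matrix (Fin m) (Fin m) K →ₗ[K] Matrix (Fin r) (Fin r) (Matrix (Fin m) (Fin m) K) where
  toFun q := Matrix.of fun u v => (B.left t u v x : Matrix (Fin m) (Fin m) K) * q *
    (B.right t u v x : Matrix (Fin m) (Fin m) K)
  map_add' p q := by ext; simp [mul_add, add_mul]
  map_smul' c q := by ext; simp

theorem GenABP.label_apply (B : GenABP D n d r) (t : Fin d) (x : Fin n)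
    (q : Matrix (Fin m) (Fin m) K) (u v : Fin r) :
    B.label t x q u v = (B.left t u v x : Matrix (Fin m) (Fin m) K) * q *
    (B.right t u v x : Matrix (Fin m) (Fin m) K) := rfl

theorem GenABP.word_rebracket {M : Type*} [Monoid M] (B : GenABP D n d r)
    (f : Matrix (Fin m) (Fin m) K →* M) (v : Fin (d + 1) → Fin r) (k : Fin d → Fin n)
    (p : Fin d → M) :
    f ((B.word v k).coeffs 0) * (List.ofFn fun t => p t * f ((B.word v k).coeffs t.succ)).prod =
      (List.ofFn fun t : Fin d => f (B.left t (v t.castSucc) (v t.succ) (k t)) * p t *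
        f (B.right t (v t.castSucc) (v t.succ) (k t))).prod := by
  have := prod_ofFn_rebracket (fun t => f (Fin.snoc (α := fun _ => Matrix (Fin m) (Fin m) K)
      (fun s : Fin d => (B.left s (v s.castSucc) (v s.succ) (k s) : Matrix _ _ K)) 1 t)) p
      (fun t => f (B.right t (v t.castSucc) (v t.succ) (k t)))
  simpa [GenABP.word] using this

/-- The inclusion as a homomorphism of monoids. -/
def inclusionHom (K : Type) [Field K] (m d : ℕ) [NeZero d] :
    Matrix (Fin m) (Fin m) K →* Matrix (Fin m × Fin d) (Fin m × Fin d) K where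
  toFun := inclusion d
  map_one' := inclusion_one
  map_mul' := inclusion_mul

theorem GenABP.word_eval_cyclicBlocks [NeZero d] (B : GenABP D n d r) (v : Fin (d + 1) → Fin r)
    (k : Fin d → Fin n) (q : Fin n → Fin d → Matrix (Fin m) (Fin m) K) :
    (B.word v k).eval (fun x => cyclicBlocks 1 (q x)) = Matrix.blockDiagonal fun s =>
      (List.ofFn fun t : Fin d => B.label t (k t) (q (k t) (s + t)) (v t.castSucc) (v t.succ)).prod := by
  have h := B.word_rebracket (inclusionHom K m d) v k (fun t => cyclicBlocks 1 (q (k t)))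
  rw [GenWord.eval]
  refine h.trans ?_
  have h1 : ∀ a b : Matrix (Fin m) (Fin m) K, ∀ p : Fin d → Matrix (Fin m) (Fin m) K,
      inclusionHom K m d a * cyclicBlocks 1 p * inclusionHom K m d b =
        cyclicBlocks 1 fun s => a * p s * b := fun a b p => by
    change inclusion d a * cyclicBlocks 1 p * inclusion d b = _
    simp [inclusion_eq_cyclicBlocks, cyclicBlocks_mul]
  simp only [h1]
  -- After `d` factors the total offset is `d`, which is zero modulo `d`: the product is block
  -- diagonal.
  rw [prod_cyclicBlocks, Fin.natCast_self, cyclicBlocks_zero]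
  simp [GenABP.label_apply]

theorem GenABP.eval_cyclicBlocks [NeZero d] (B : GenABP D n d r)
    (q : Fin n → Fin d → Matrix (Fin m) (Fin m) K) :
    B.eval (fun x => cyclicBlocks 1 (q x)) = Matrix.blockDiagonal fun s =>
      (List.ofFn fun t : Fin d => ∑ x, B.label t x (q x (s + t))).prod B.source B.sink := by
  classical
  have h1 : ∀ s : Fin d,
      (List.ofFn fun t : Fin d => ∑ x, B.label t x (q x (s + t))).prod B.source B.sink =
      ∑ v ∈ B.paths, ∑ k : Fin d → Fin n, (List.ofFn fun t : Fin d =>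
        B.label t (k t) (q (k t) (s + t)) (v t.castSucc) (v t.succ)).prod := by
    intro s
    rw [matrix_prod_ofFn_apply]
    refine Finset.sum_congr rfl fun v _ => ?_
    have := prod_ofFn_sum_smul (K := K) (fun (_ : Fin d) (_ : Fin n) => 1) (fun t x =>
      B.label t x (q x (s + t)) (v t.castSucc) (v t.succ))
    simpa [Matrix.sum_apply] using this
  simp only [h1, GenABP.eval, B.word_eval_cyclicBlocks]
  ext ⟨i, s⟩ ⟨j, s'⟩
  simp only [Matrix.sum_apply, Matrix.blockDiagonal_apply]
  split_ifs <;> simp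

theorem GenABP.prod_label_mem [NeZero d] (B : GenABP D n d r)
    {q : Fin d → Fin n → Matrix (Fin m) (Fin m) K} (hq : ∀ t x, q t x ∈ D) (u v : Fin r) :
    (List.ofFn fun t : Fin d => ∑ x, B.label t x (q t x)).prod u v ∈ D := by
  rw [matrix_prod_ofFn_apply]
  refine sum_mem fun v _ => list_prod_mem fun y hy => ?_
  obtain ⟨t, rfl⟩ := List.mem_ofFn.1 hy
  rw [Matrix.sum_apply]
  exact sum_mem fun x _ => mul_mem (mul_mem (Subtype.property _) (hq t x)) (Subtype.property _)

/-- The coefficient of a canonical monomial is an entry of a product of labels at matrix units. -/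
theorem GenABP.coeff_eq (B : GenABP D n d r) (μ : GenMonomial m n d) :
    B.coeff μ = (List.ofFn fun t : Fin d => B.label t (μ.vars t)
      (Matrix.single (μ.col t.castSucc) (μ.row t.succ) 1)).prod B.source B.sink
        (μ.row 0) (μ.col (Fin.last d)) := by
  rw [matrix_prod_ofFn_apply, Matrix.sum_apply, GenABP.coeff]
  refine Finset.sum_congr rfl fun v _ => ?_
  rw [Finset.sum_eq_single μ.vars]
  · have h := B.word_rebracket (MonoidHom.id _) v μ.vars
      (fun t => Matrix.single (μ.col t.castSucc) (μ.row t.succ) (1 : K))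
    simp only [MonoidHom.id_apply] at h
    simp only [GenABP.label_apply, ← h]
    rw [prod_single_mul_apply]
    exact if_pos rfl
  · intro k _ hk
    exact if_neg hk
  · simp

end Labels

/-! ### The output points and the hitting property -/

section Points

variable {N : ℕ} [NeZero N] {k : (ZMod N)ˣ} {ℓ n d : ℕ}

theorem choicePoint_value [NeZero ℓ] [NeZero d] (Q B Λ g : ℕ) (x : Fin n) :
    SymbPoint.value N (choicePoint n ℓ d (k : ZMod N).val Q B Λ g) x =
      cyclicBlocks 1 fun s => ∑ p : Fin ℓ × Fin ℓ,
        (choiceCoeff Q B Λ g (varCode ℓ x p.1 p.2) s : KField N) • basisElem N k ℓ p.1 p.2 := by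
  ext ⟨i, j⟩ ⟨i', j'⟩
  have hval : ∀ (f : ℕ → ℤ × ℕ × ℕ), Symb.value N ((List.range ℓ).map f) =
      ∑ a : Fin ℓ, ((f a).1 : KField N) * omega N ^ (f a).2.1 * zvar N ^ (f a).2.2 := by
    intro f
    rw [Symb.value, List.map_map, ← Finset.sum_range
      (fun a => ((f a).1 : KField N) * omega N ^ (f a).2.1 * zvar N ^ (f a).2.2)]
    rfl
  simp only [SymbPoint.value, Matrix.of_apply, choicePoint, hval, cyclicBlocks]
  have hjj : j' = j + 1 ↔ (j' : ℕ) = ((j : ℕ) + 1) % d := by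
    rw [Fin.ext_iff, Fin.val_add, Fin.val_one', Nat.add_mod_mod]
  by_cases hj : j' = j + 1
  · rw [if_pos hj]
    -- In truncated arithmetic `1 - ((x - y) + (y - x))` is the indicator of `x = y`; it selects the
    -- blocks with `j' = j + 1`.
    have hδ : 1 - ((j' : ℕ) - ((j : ℕ) + 1) % d + (((j : ℕ) + 1) % d - j')) = 1 := by
      rw [hjj] at hj; omega
    rw [Matrix.sum_apply, Fintype.sum_prod_type]
    refine Finset.sum_congr rfl fun a _ => ?_
    have hb : ((i' - i : Fin ℓ) : ℕ) = ((i' : ℕ) + ℓ - i) % ℓ := by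
      rw [Fin.val_sub]
      congr 1
      omega
    rw [Finset.sum_eq_single (i' - i)]
    · simp only [Matrix.smul_apply, basisElem_apply, smul_eq_mul, Fin.cast_val_eq_self,
        add_sub_cancel, if_true, hδ, one_mul]
      rw [hb]
      -- Going from row `i` to column `i'` wraps around at most once, namely when `i' < i`.
      have he : ((i : ℕ) + ((i' : ℕ) + ℓ - i) % ℓ) / ℓ = 1 - (1 - ((i : ℕ) - i')) := by
        have h1 := i.2
        have h2 := i'.2
        by_cases h : (i' : ℕ) < i
        · rw [Nat.mod_eq_of_lt (by omega), show (i : ℕ) + ((i' : ℕ) + ℓ - i) = i' + ℓ by omega,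
            Nat.add_div_right _ (by omega), Nat.div_eq_of_lt h2]
          omega
        · rw [show (i' : ℕ) + ℓ - i = (i' - i) + ℓ by omega, Nat.add_mod_right,
            Nat.mod_eq_of_lt (by omega), show (i : ℕ) + (i' - i) = i' by omega,
            Nat.div_eq_of_lt h2]
          omega
      rw [he, Int.cast_natCast, mul_assoc]
    · intro b _ hb
      simp only [Matrix.smul_apply, basisElem_apply, smul_eq_mul, Fin.cast_val_eq_self]
      rw [if_neg, mul_zero]
      rintro rfl
      exact hb (by simp)
    · simp
  · rw [if_neg hj]
    have hδ : 1 - ((j' : ℕ) - ((j : ℕ) + 1) % d + (((j : ℕ) + 1) % d - j')) = 0 := by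
      rw [hjj] at hj; omega
    simp [hδ]

end Points

theorem varCode_injective {ℓ n : ℕ} :
    Function.Injective fun v : Fin n × Fin ℓ × Fin ℓ => varCode ℓ v.1 v.2.1 v.2.2 := by
  rintro ⟨x, a, b⟩ ⟨x', a', b'⟩ h
  simp only [varCode] at h
  have hℓ : 0 < ℓ := (Nat.zero_le _).trans_lt a.2
  have h1 := congr_arg (· % ℓ) h
  have h2 := congr_arg (· / ℓ) h
  simp only [Nat.mul_add_mod_self_right, Nat.mod_eq_of_lt b.2, Nat.mod_eq_of_lt b'.2] at h1
  have hdiv : ∀ (y : ℕ) (b : Fin ℓ), (y * ℓ + b) / ℓ = y := fun y b => by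
    rw [Nat.mul_comm, Nat.mul_add_div hℓ, Nat.div_eq_of_lt b.2, add_zero]
  simp only [hdiv] at h2
  have h3 := congr_arg (· % ℓ) h2
  have h4 := congr_arg (· / ℓ) h2
  simp only [Nat.mul_add_mod_self_right, Nat.mod_eq_of_lt a.2, Nat.mod_eq_of_lt a'.2] at h3
  simp only [hdiv] at h4
  simp [Fin.ext_iff, h1, h3, h4]

/-- The hitting property. -/
theorem exists_isUnit_eval {N : ℕ} [NeZero N] {k : (ZMod N)ˣ} {n ℓ r d : ℕ} (hk : orderOf k = ℓ)
    (hn : 0 < n) (hr : 0 < r) (hd : 0 < d) (B : GenABP (cyclicAlgebra N k ℓ) n d r)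
    (hB : B.IsNonzero) :
    ∃ P ∈ hittingSet n ℓ r d (k : ZMod N).val, IsUnit (B.eval (SymbPoint.value N P)) := by
  classical
  have hℓ : 0 < ℓ := hk ▸ orderOf_pos k
  have : NeZero ℓ := ⟨hℓ.ne'⟩
  have : NeZero d := ⟨hd.ne'⟩
  obtain ⟨μ, hμ⟩ := hB
  rw [B.coeff_eq] at hμ
  -- The functional reads off the coefficient of the monomial `μ`, which is nonzero when matrix
  -- units are substituted in the labels.
  let L : Matrix (Fin r) (Fin r) (Matrix (Fin ℓ) (Fin ℓ) (KField N)) →ₗ[KField N] KField N :=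
    { toFun := fun X => X B.source B.sink (μ.row 0) (μ.col (Fin.last d))
      map_add' := fun _ _ => rfl
      map_smul' := fun _ _ => rfl }
  -- Positions from `d` on are filled with `0`; only those below `d` enter the product.
  let A : ℕ → Fin n × Fin ℓ × Fin ℓ → Matrix (Fin r) (Fin r) (Matrix (Fin ℓ) (Fin ℓ) (KField N)) :=
    fun t v => if h : t < d then B.label ⟨t, h⟩ v.1 (basisElem N k ℓ v.2.1 v.2.2) else 0
  have hA : ∀ (t : Fin d) v, A t v = B.label t v.1 (basisElem N k ℓ v.2.1 v.2.2) := fun t v =>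
    dif_pos t.2
  have hf₀ : ∃ f₀ : Fin d → Fin n × Fin ℓ × Fin ℓ,
      L (List.ofFn fun t : Fin d => A t (f₀ t)).prod ≠ 0 := by
    by_contra! h
    have hμ' : L (List.ofFn fun t : Fin d => B.label t (μ.vars t)
      (Matrix.single (μ.col t.castSucc) (μ.row t.succ) 1)).prod ≠ 0 := hμ
    apply hμ'
    choose c hc using fun t : Fin d =>
      -- By multilinearity, vanishing on all products of spanning elements would force vanishing at
      -- the matrix units.
      exists_sum_basisElem hk (μ.col t.castSucc) (μ.row t.succ)
    simp only [hc, map_sum, map_smul]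
    rw [prod_ofFn_sum_smul, map_sum]
    refine Finset.sum_eq_zero fun f _ => ?_
    rw [map_smul]
    have := h fun t => (μ.vars t, f t)
    simp only [hA] at this
    rw [this, smul_zero]
  obtain ⟨f₀, hf₀⟩ := hf₀
  have hpos : 0 < n * r * d * ℓ := by positivity
  have hdP : d + 1 ≤ paramP n ℓ r d := by
    have : d ≤ n * r * d * ℓ := by
      calc d ≤ d * (n * r * ℓ) := Nat.le_mul_of_pos_right _ (by positivity)
        _ = _ := by ring
    unfold paramP; omega
  have hfin : Module.finrank (KField N)
      (Matrix (Fin r) (Fin r) (Matrix (Fin ℓ) (Fin ℓ) (KField N))) ≤ paramP n ℓ r d ^ 2 := by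
    simp only [Module.finrank_matrix, Fintype.card_fin, Module.finrank_self, mul_one]
    have h1 : r * ℓ ≤ paramP n ℓ r d := by
      have : r * ℓ ≤ r * ℓ * (n * d) := Nat.le_mul_of_pos_right _ (by positivity)
      unfold paramP; nlinarith
    calc r * r * (ℓ * ℓ) = (r * ℓ) ^ 2 := by ring
      _ ≤ _ := Nat.pow_le_pow_left h1 2
  have hm : d * d * (n * ℓ * ℓ) ≤ paramP n ℓ r d ^ 2 := by
    have h1 : n * r * d * ℓ ≤ paramP n ℓ r d := by unfold paramP; omega
    calc d * d * (n * ℓ * ℓ) ≤ d * d * (n * ℓ * ℓ) * (n * r * r) :=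
          Nat.le_mul_of_pos_right _ (by positivity)
      _ = (n * r * d * ℓ) ^ 2 := by ring
      _ ≤ _ := Nat.pow_le_pow_left h1 2
  have hΛ : d ≤ 2 ^ d.size := (Nat.lt_size_self d).le
  obtain ⟨g, hg, hgs⟩ := exists_choice_ne_zero (K := KField N) (A := A) varCode_injective hd hdP hfin
    (fun v => varCode_lt v.1.2 v.2.1.2 v.2.2.2) hm hΛ L f₀ hf₀
  refine ⟨_, List.mem_map.2 ⟨g, List.mem_range.2 hg, rfl⟩, ?_⟩
  set Q := paramQ (paramP n ℓ r d)
  set Bb := paramB (paramP n ℓ r d)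
  set q : Fin n → Fin d → Matrix (Fin ℓ) (Fin ℓ) (KField N) := fun x s =>
    ∑ p : Fin ℓ × Fin ℓ, (choiceCoeff Q Bb d.size g (varCode ℓ x p.1 p.2) s : KField N) •
      basisElem N k ℓ p.1 p.2 with hq
  have hval : SymbPoint.value N (choicePoint n ℓ d (k : ZMod N).val Q Bb d.size g) =
      fun x => cyclicBlocks 1 (q x) := funext fun x => choicePoint_value _ _ _ _ x
  rw [hval, B.eval_cyclicBlocks]
  have hunit : IsUnit fun s : Fin d =>
      (List.ofFn fun t : Fin d => ∑ x, B.label t x (q x (s + t))).prod B.source B.sink := by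
    rw [Pi.isUnit_iff]
    intro s
    refine isUnit_of_mem_cyclicAlgebra hk
      (B.prod_label_mem (q := fun t x => q x (s + t)) (fun t x => ?_) _ _) fun h0 => ?_
    · refine sum_mem fun p _ => ?_
      -- `D` is not assumed to be closed under scalars from `K`; the coefficients are natural
      -- numbers, so the blocks stay in `D`.
      rw [Nat.cast_smul_eq_nsmul]
      exact nsmul_mem (basisElem_mem _ _) _
    · refine hgs s s.2 ?_
      have h1 : ∀ t : Fin d, ∑ v : Fin n × Fin ℓ × Fin ℓ, (choiceCoeff Q Bb d.size g
          (varCode ℓ v.1 v.2.1 v.2.2) (((s : ℕ) + t) % d) : KField N) • A t v =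
          ∑ x, B.label t x (q x (s + t)) := by
        intro t
        rw [Fintype.sum_prod_type]
        refine Finset.sum_congr rfl fun x _ => ?_
        simp only [hq, map_sum, map_smul, hA, Fin.val_add]
      simp only [h1]
      change (List.ofFn fun t : Fin d => ∑ x, B.label t x (q x (s + t))).prod B.source B.sink
        (μ.row 0) (μ.col (Fin.last d)) = 0
      rw [h0]; rfl
  -- A block diagonal matrix with invertible blocks is invertible.
  exact hunit.map (Matrix.blockDiagonalRingHom (Fin ℓ) (Fin d) (KField N))

end GenABPHitting

theorem mainTheorem4 :
    ∃ (prog : GenABPHitting.RProg) (c : ℕ),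
      ∀ (N : ℕ) [NeZero N] (k : (ZMod N)ˣ) (n ℓ r d : ℕ),
        orderOf k = ℓ → 0 < n → 0 < r → 0 < d →
        ∃ (H : List (GenABPHitting.SymbPoint n ℓ d)) (s : GenABPHitting.RState) (T : ℕ),
          GenABPHitting.RExec prog
            (GenABPHitting.RState.init [n, ℓ, r, d, N, (k : ZMod N).val]) s T ∧
          s.out = H.flatMap GenABPHitting.SymbPoint.encode ∧
          T ≤ 2 ^ ((Nat.log 2 (n * r * d * ℓ * N.size) + c) ^ c) ∧
          H.length ≤ (n * r * d * ℓ + 1) ^ (c * (Nat.log 2 (n * d * ℓ) + 1)) ∧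
          ∀ B : GenABPHitting.GenABP (GenABPHitting.cyclicAlgebra N k ℓ) n d r,
            B.IsNonzero →
              ∃ P ∈ H, IsUnit (B.eval (GenABPHitting.SymbPoint.value N P)) := by
  refine ⟨GenABPHitting.hittingProg, 42, fun N _ k n ℓ r d hk hn hr hd => ?_⟩
  have hℓ : 0 < ℓ := hk ▸ orderOf_pos k
  obtain ⟨s, T, h1, h2, h3⟩ := GenABPHitting.hittingProg_time hn hℓ hr hd
    (Nat.pos_of_ne_zero (NeZero.ne N)) (ZMod.val_lt (k : ZMod N)).le
  exact ⟨GenABPHitting.hittingSet n ℓ r d (k : ZMod N).val, s, T, h1, h2, h3,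
    GenABPHitting.length_hittingSet_le _ hn hℓ hr hd,
    fun B hB => GenABPHitting.exists_isUnit_eval hk hn hr hd B hB⟩
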